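/- **Setting.** Let $2\le K$ and let $M$ data sequences $X^{(i)}=(X^{(i)}_1,X^{(i)}_2,\dots)$, $i=1,\dots,M$, be given on a probability space, where $X^{(i)}$ is i.i.d. with law $p_i$. The index set $\{1,\dots,M\}$ is partitioned into $K$ nonempty true clusters $P_1,\dots,P_K$. The distance $d$ between distributions and its estimate $\hat d(i,j,n)$ from the first $n$ samples of the sequences $i$ and $j$ are one of the following. (a) *MMD*: the samples take values in a measurable space, $k$ is the reproducing kernel of a real reproducing kernel Hilbert space $\mathcal H$, it is jointly measurable, $0\le k(x,y)\le\mathbb G$ for all $x,y$, and $$d(p,q)=\sup_{f\in\mathcal H,\ \|f\|\le1}\bigl(E_p f-E_q f\bigr),$$ $$\hat d(i,j,n)=\Bigl\{\tfrac1{n^2}\sum_{l,m=1}^n\bigl[k(X^{(i)}_l,X^{(i)}_m)+k(X^{(j)}_l,X^{(j)}_m)-2k(X^{(i)}_l,X^{(j)}_m)\bigr]\Bigr\}^{1/2}.$$ (b) *KSD*: the samples are real, $d(p,q)=\sup_{a\in\mathbb R}|F_p(a)-F_q(a)|$ with $F$ the distribution function, and $\hat d(i,j,n)=\sup_{a\in\mathbb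 R}|\hat F^{(n)}_i(a)-\hat F^{(n)}_j(a)|$ with $\hat F^{(n)}_i$ the empirical distribution function of the first $n$ samples of $X^{(i)}$. Put $$d_H=\min_{k\ne l}\ \min_{i\in P_k,\ j\in P_l}d(p_i,p_j),\qquad d_I=\max_{k}\ \max_{P_k=A\sqcup B,\ A,B\ne\emptyset}\ \min_{i\in A,\ j\in B}d(p_i,p_j)$$ ($d_I=0$ if all clusters are singletons), and assume $d_I<d_H$. **Algorithm.** For each $n\ge2$, let $\{C_1(n),\dots,C_K(n)\}$ be the output of single-linkage clustering with the distances $\hat d(\cdot,\cdot,n)$: start from $M$ singletons and repeatedly merge two clusters $A\neq B$ minimizing $\min_{i\in A,j\in B}\hat d(i,j,n)$, until $K$ clusters are left; ties are broken by an arbitrary fixed rule that selects one of the minimizing pairs. Let $\Gamma_n=\min_{k\ne l}\min_{i\in C_k(n),\,j\in C_l(n)}\hat d(i,j,n)$. For $C>0$ the stopping time of SLINK-SEQ is $$N=N_C=\inf\{n\ge2:\ \Gamma_n\ge C/\sqrt n\}\in\{2,3,\dots\}\cup\{\infty\}.$$ **Theorem.** For both choices of the distance, $N_C$ is a (measurable)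 random variable for every $C>0$, and $$\lim_{C\to\infty}\mathbb E\left[\left|\frac{N_C}{C^2}-\frac1{d_H^2}\right|\right]=0 .$$ -/

import Mathlib

open MeasureTheory ProbabilityTheory Filter Topology
open scoped ENNReal

namespace SlinkSeq

noncomputable section

/-! ### Distances between distributions and their estimates -/

/-- The scalar kernel `k(x, y)` of a real reproducing kernel Hilbert space `H` of functions on
`𝒳`. -/
def ker {𝒳 : Type*} (H : Type*) [NormedAddCommGroup H] [InnerProductSpace ℝ H] [CompleteSpace H]
    [RKHS ℝ H 𝒳 ℝ] (x y : 𝒳) : ℝ :=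
  RKHS.kernel H x y 1

/-- Maximum mean discrepancy: the supremum of `E_p f - E_q f` over the unit ball of the reproducing
kernel Hilbert space `H`. -/
def mmd {𝒳 : Type*} [MeasurableSpace 𝒳] (H : Type*) [NormedAddCommGroup H] [InnerProductSpace ℝ H]
    [CompleteSpace H] [RKHS ℝ H 𝒳 ℝ] (p q : Measure 𝒳) : ℝ :=
  sSup {r : ℝ | ∃ f : H, ‖f‖ ≤ 1 ∧ r = (∫ x, f x ∂p) - ∫ x, f x ∂q}

/-- The (biased) estimate of the maximum mean discrepancy from the first `n` samples of the two
sequences `x` and `y` (samples are numbered from `0`). -/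
def mmdEst {𝒳 : Type*} (H : Type*) [NormedAddCommGroup H] [InnerProductSpace ℝ H] [CompleteSpace H]
    [RKHS ℝ H 𝒳 ℝ] (n : ℕ) (x y : ℕ → 𝒳) : ℝ :=
  Real.sqrt ((1 / (n : ℝ) ^ 2) * ∑ l ∈ Finset.range n, ∑ m ∈ Finset.range n,
    (ker H (x l) (x m) + ker H (y l) (y m) - 2 * ker H (x l) (y m)))

/-- Kolmogorov-Smirnov distance between two distributions on the real line. -/
def ks (p q : Measure ℝ) : ℝ :=
  ⨆ a : ℝ, |cdf p a - cdf q a|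

/-- Empirical distribution function of the first `n` samples of `x`. -/
def empCdf (n : ℕ) (x : ℕ → ℝ) (a : ℝ) : ℝ :=
  (1 / (n : ℝ)) * ∑ l ∈ Finset.range n, (Set.Iic a).indicator (fun _ => (1 : ℝ)) (x l)

/-- The estimate of the Kolmogorov-Smirnov distance from the first `n` samples of the two
sequences `x` and `y`. -/
def ksEst (n : ℕ) (x y : ℕ → ℝ) : ℝ :=
  ⨆ a : ℝ, |empCdf n x a - empCdf n y a|

/-! ### Cluster distances. Data sequences are indexed by `Fin M`; `d i j` is the distance between
the sequences `i` and `j` (either a true distance or an estimate). -/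

/-- The smallest distance between a sequence in `A` and a sequence in `B`. -/
def setDist {M : ℕ} (d : Fin M → Fin M → ℝ) (A B : Finset (Fin M)) : ℝ :=
  sInf {r : ℝ | ∃ i ∈ A, ∃ j ∈ B, r = d i j}

/-- The minimum inter-cluster distance of a clustering `𝒞`. -/
def interDist {M : ℕ} (d : Fin M → Fin M → ℝ) (𝒞 : Finset (Finset (Fin M))) : ℝ :=
  sInf {r : ℝ | ∃ A ∈ 𝒞, ∃ B ∈ 𝒞, A ≠ B ∧ r = setDist d A B}

/-- The set of indices of the sequences in cluster `k`, where `c i` is the cluster of sequence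
`i`. -/
def cluster {M K : ℕ} (c : Fin M → Fin K) (k : Fin K) : Finset (Fin M) :=
  Finset.univ.filter fun i => c i = k

/-- The true clustering. -/
def trueClusters {M K : ℕ} (c : Fin M → Fin K) : Finset (Finset (Fin M)) :=
  Finset.univ.image (cluster c)

/-- `d_H`, the minimum inter-cluster distance of the true clustering. -/
def dH {M K : ℕ} (d : Fin M → Fin M → ℝ) (c : Fin M → Fin K) : ℝ :=
  interDist d (trueClusters c)

/-- `d_I`, the maximum over all true clusters, and over all partitions of the cluster into two
nonempty sub-clusters, of the distance between the two sub-clusters. It is `0` when every cluster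
is a singleton, as there is no such partition then. -/
def dI {M K : ℕ} (d : Fin M → Fin M → ℝ) (c : Fin M → Fin K) : ℝ :=
  sSup {r : ℝ | ∃ k : Fin K, ∃ A B : Finset (Fin M), A.Nonempty ∧ B.Nonempty ∧ Disjoint A B ∧
    A ∪ B = cluster c k ∧ r = setDist d A B}

/-! ### Single linkage clustering -/

/-- The pairs of distinct clusters of `𝒞` that are closest to each other. -/
def closestPairs {M : ℕ} (d : Fin M → Fin M → ℝ) (𝒞 : Finset (Finset (Fin M))) :
    Finset (Finset (Fin M) × Finset (Fin M)) :=
  open Classical in 𝒞.offDiag.filter fun q => setDist d q.1 q.2 = interDist d 𝒞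

/-- A rule that selects one of several candidate pairs of clusters, used to break ties. -/
def IsTieBreak {M : ℕ}
    (tie : Finset (Finset (Fin M) × Finset (Fin M)) → Finset (Fin M) × Finset (Fin M)) : Prop :=
  ∀ S : Finset (Finset (Fin M) × Finset (Fin M)), S.Nonempty → tie S ∈ S

/-- One step of single linkage clustering: two closest clusters are merged. -/
def slinkStep {M : ℕ}
    (tie : Finset (Finset (Fin M) × Finset (Fin M)) → Finset (Fin M) × Finset (Fin M))
    (d : Fin M → Fin M → ℝ) (𝒞 : Finset (Finset (Fin M))) : Finset (Finset (Fin M)) :=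
  let q := tie (closestPairs d 𝒞)
  insert (q.1 ∪ q.2) ((𝒞.erase q.1).erase q.2)

/-- Single linkage clustering with `K` output clusters: start from the `M` singletons and merge
until `K` clusters are left, i.e. `M - K` times. -/
def slink {M : ℕ} (K : ℕ)
    (tie : Finset (Finset (Fin M) × Finset (Fin M)) → Finset (Fin M) × Finset (Fin M))
    (d : Fin M → Fin M → ℝ) : Finset (Finset (Fin M)) :=
  (slinkStep tie d)^[M - K] (Finset.univ.image fun i => {i})

/-! ### The sequential algorithm -/

/-- The stopping time: the first `n ≥ 2` at which the minimum inter-cluster distance of the SLINK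
output, computed from the estimated distances `dhat n`, is at least `C / √n`; it is `⊤` if there is
no such `n`. -/
def stoppingTime {M : ℕ} (K : ℕ)
    (tie : Finset (Finset (Fin M) × Finset (Fin M)) → Finset (Fin M) × Finset (Fin M))
    (dhat : ℕ → Fin M → Fin M → ℝ) (C : ℝ) : ℕ∞ :=
  ⨅ n : ℕ, ⨅ _ : 2 ≤ n ∧ C / Real.sqrt n ≤ interDist (dhat n) (slink K tie (dhat n)), (n : ℕ∞)

/-- Each `X i` is a sequence of independent random variables with common law `p i`. -/
def IsIIDFamily {Ω 𝒳 : Type*} [MeasurableSpace Ω] [MeasurableSpace 𝒳] {M : ℕ} (μ : Measure Ω)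
    (X : Fin M → ℕ → Ω → 𝒳) (p : Fin M → Measure 𝒳) : Prop :=
  ∀ i, (∀ l, Measurable (X i l)) ∧ iIndepFun (X i) μ ∧ ∀ l, μ.map (X i l) = p i

/-- `E |N / C² - a|`, as an extended nonnegative real. -/
def meanDeviation {Ω : Type*} [MeasurableSpace Ω] (μ : Measure Ω) (N : Ω → ℕ∞) (C a : ℝ) : ℝ≥0∞ :=
  ∫⁻ ω, (((N ω : ℝ≥0∞) : EReal) / ((C ^ 2 : ℝ) : EReal) - (a : EReal)).abs ∂μ

end

end SlinkSeq

open SlinkSeq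

/-!
The argument has a deterministic part and a probabilistic part.

*Clustering.* If all estimated distances are within `ε < (d_H - d_I) / 2` of the true ones, single
linkage clustering only ever merges clusters lying in the same true cluster: as long as there are
more than `K` clusters, some true cluster is split, so some pair of clusters has true distance at
most `d_I`, while clusters from different true clusters have distance at least `d_H`. Hence the
output is the true clustering, and its minimum inter-cluster distance `Γ n` is within `ε` of `d_H`
(`abs_interDist_slink_sub_dH_le`).

*Stopping time.* Let `S = ∑ n, n * 1_{E n}`, where `E n` is the event that some estimate from `n`
samples is off by more than `ε`. Beyond `S` every `n` is good, so `N ≤ C² / (d_H - ε)² + S + 2`.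
Conversely either `N` is good and `N ≥ C² / (d_H + ε)²`, or `N ≤ S`, and then, as `Γ` is bounded by
some `B`, `S ≥ N ≥ C² / B²`. So `|N / C² - 1 / d_H²|` is at most a quantity that vanishes with `ε`
plus `O((S + 1) / C²)`, pointwise (`exists_stopping_eq_abs_sub_le`), and the `L¹` convergence
follows from `𝔼 S = ∑ n, n * μ (E n) < ∞` (`tendsto_meanDeviation`). No uniform integrability is needed.

*Concentration.* For both distances the error splits into one error per sequence, and this error is
small as soon as the averages `(1 / n) ∑ m, h (X l) (X m)`, `l < n`, are small for a bounded kernel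
`h` with `𝔼 h(x, X) = 0` for all `x`. Given `X l`, such an average is a sum of independent centred
variables up to its diagonal term, so Hoeffding's inequality and a union bound over `l` give
exponentially small probabilities (`tsum_mul_measure_exists_lt_ne_top`). For the maximum mean
discrepancy, `h(x, y) = ⟪k_x - m, k_y - m⟫` with `m` the mean embedding of the law. For the
Kolmogorov-Smirnov distance, `h(x, y)` is `1_{y ≤ x} - p (-∞, x]` or `1_{y < x} - p (-∞, x)`, since
the largest deviations of an empirical distribution function occur at samples or at their left
limits.
-/

namespace SlinkSeq

/-! ### Cluster distances -/

section Distances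

variable {M K : ℕ} {d e : Fin M → Fin M → ℝ} {c : Fin M → Fin K}

lemma finite_setDist (d : Fin M → Fin M → ℝ) (A B : Finset (Fin M)) :
    {r : ℝ | ∃ i ∈ A, ∃ j ∈ B, r = d i j}.Finite := by
  refine (Set.finite_range fun q : Fin M × Fin M => d q.1 q.2).subset ?_
  rintro r ⟨i, -, j, -, rfl⟩
  exact ⟨(i, j), rfl⟩

lemma finite_interDist (d : Fin M → Fin M → ℝ) (𝒞 : Finset (Finset (Fin M))) :
    {r : ℝ | ∃ A ∈ 𝒞, ∃ B ∈ 𝒞, A ≠ B ∧ r = setDist d A B}.Finite := by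
  refine (Set.finite_range fun q : Finset (Fin M) × Finset (Fin M) => setDist d q.1 q.2).subset ?_
  rintro r ⟨A, -, B, -, -, rfl⟩
  exact ⟨(A, B), rfl⟩

lemma finite_dI (d : Fin M → Fin M → ℝ) (c : Fin M → Fin K) :
    {r : ℝ | ∃ k : Fin K, ∃ A B : Finset (Fin M), A.Nonempty ∧ B.Nonempty ∧ Disjoint A B ∧
      A ∪ B = cluster c k ∧ r = setDist d A B}.Finite := by
  refine (Set.finite_range fun q : Finset (Fin M) × Finset (Fin M) => setDist d q.1 q.2).subset ?_
  rintro r ⟨k, A, B, -, -, -, -, rfl⟩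
  exact ⟨(A, B), rfl⟩

lemma setDist_le {A B : Finset (Fin M)} {i j : Fin M} (hi : i ∈ A) (hj : j ∈ B) :
    setDist d A B ≤ d i j :=
  csInf_le (finite_setDist d A B).bddBelow ⟨i, hi, j, hj, rfl⟩

lemma exists_setDist_eq {A B : Finset (Fin M)} (hA : A.Nonempty) (hB : B.Nonempty) :
    ∃ i ∈ A, ∃ j ∈ B, setDist d A B = d i j := by
  obtain ⟨i, hi⟩ := hA
  obtain ⟨j, hj⟩ := hB
  have hne : {r : ℝ | ∃ i ∈ A, ∃ j ∈ B, r = d i j}.Nonempty := ⟨_, i, hi, j, hj, rfl⟩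
  exact hne.csInf_mem (finite_setDist d A B)

lemma interDist_le {𝒞 : Finset (Finset (Fin M))} {A B : Finset (Fin M)} (hA : A ∈ 𝒞) (hB : B ∈ 𝒞)
    (hAB : A ≠ B) : interDist d 𝒞 ≤ setDist d A B :=
  csInf_le (finite_interDist d 𝒞).bddBelow ⟨A, hA, B, hB, hAB, rfl⟩

lemma exists_interDist_eq {𝒞 : Finset (Finset (Fin M))} (h : 1 < 𝒞.card) :
    ∃ A ∈ 𝒞, ∃ B ∈ 𝒞, A ≠ B ∧ interDist d 𝒞 = setDist d A B := by
  obtain ⟨A, hA, B, hB, hAB⟩ := Finset.one_lt_card.1 h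
  have hne : {r : ℝ | ∃ A ∈ 𝒞, ∃ B ∈ 𝒞, A ≠ B ∧ r = setDist d A B}.Nonempty :=
    ⟨_, A, hA, B, hB, hAB, rfl⟩
  exact hne.csInf_mem (finite_interDist d 𝒞)

/-- The minimum inter-cluster distance of an arbitrary collection of sets is at most any nonnegative
bound on the distances; nonnegativity covers the value `sInf ∅ = 0`. -/
lemma interDist_le_of_forall_le {b : ℝ} (hb : 0 ≤ b) (h : ∀ i j, d i j ≤ b)
    (𝒞 : Finset (Finset (Fin M))) : interDist d 𝒞 ≤ b := by
  have hset (A B : Finset (Fin M)) : setDist d A B ≤ b := by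
    by_cases hAB : A.Nonempty ∧ B.Nonempty
    · obtain ⟨i, -, j, -, hij⟩ := exists_setDist_eq (d := d) hAB.1 hAB.2
      exact hij ▸ h i j
    · have : {r : ℝ | ∃ i ∈ A, ∃ j ∈ B, r = d i j} = ∅ := by
        ext r
        simp only [Set.mem_ofPred_eq, Set.mem_empty_iff_false, iff_false]
        rintro ⟨i, hi, j, hj, -⟩
        exact hAB ⟨⟨i, hi⟩, ⟨j, hj⟩⟩
      rw [setDist, this, Real.sInf_empty]
      exact hb
  by_cases hC : 1 < 𝒞.card
  · obtain ⟨A, -, B, -, -, hAB⟩ := exists_interDist_eq (d := d) hC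
    exact hAB ▸ hset A B
  · have : {r : ℝ | ∃ A ∈ 𝒞, ∃ B ∈ 𝒞, A ≠ B ∧ r = setDist d A B} = ∅ := by
      ext r
      simp only [Set.mem_ofPred_eq, Set.mem_empty_iff_false, iff_false]
      rintro ⟨A, hA, B, hB, hAB, -⟩
      exact hC (Finset.one_lt_card.2 ⟨A, hA, B, hB, hAB⟩)
    rw [interDist, this, Real.sInf_empty]
    exact hb

lemma interDist_le_add {ε : ℝ} (h : ∀ i j, d i j ≤ e i j + ε) {𝒞 : Finset (Finset (Fin M))}
    (hne : ∀ A ∈ 𝒞, A.Nonempty) (hC : 1 < 𝒞.card) : interDist d 𝒞 ≤ interDist e 𝒞 + ε := by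
  obtain ⟨A, hA, B, hB, hAB, hq⟩ := exists_interDist_eq (d := e) hC
  obtain ⟨i, hi, j, hj, hij⟩ := exists_setDist_eq (d := e) (hne A hA) (hne B hB)
  rw [hq, hij]
  exact (interDist_le hA hB hAB).trans ((setDist_le hi hj).trans (h i j))

lemma mem_cluster {k : Fin K} {i : Fin M} : i ∈ cluster c k ↔ c i = k := by
  simp [cluster]

lemma mem_trueClusters {A : Finset (Fin M)} : A ∈ trueClusters c ↔ ∃ k, cluster c k = A := by
  simp [trueClusters]

lemma nonempty_of_mem_trueClusters (hc : Function.Surjective c) {A : Finset (Fin M)}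
    (hA : A ∈ trueClusters c) : A.Nonempty := by
  obtain ⟨k, rfl⟩ := mem_trueClusters.1 hA
  obtain ⟨i, hi⟩ := hc k
  exact ⟨i, mem_cluster.2 hi⟩

lemma card_trueClusters (hc : Function.Surjective c) : (trueClusters c).card = K := by
  rw [trueClusters, Finset.card_image_of_injective, Finset.card_univ, Fintype.card_fin]
  intro k l hkl
  obtain ⟨i, rfl⟩ := hc k
  exact mem_cluster.1 (hkl ▸ mem_cluster.2 rfl)

lemma dH_le {i j : Fin M} (hij : c i ≠ c j) : dH d c ≤ d i j := by
  have h : setDist d (cluster c (c i)) (cluster c (c j)) ≤ d i j :=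
    setDist_le (mem_cluster.2 rfl) (mem_cluster.2 rfl)
  refine (interDist_le (mem_trueClusters.2 ⟨_, rfl⟩) (mem_trueClusters.2 ⟨_, rfl⟩) ?_).trans h
  intro heq
  exact hij (mem_cluster.1 (heq ▸ mem_cluster.2 rfl : i ∈ cluster c (c j)))

lemma setDist_le_dI {k : Fin K} {A B : Finset (Fin M)} (hA : A.Nonempty) (hB : B.Nonempty)
    (hAB : Disjoint A B) (hk : A ∪ B = cluster c k) : setDist d A B ≤ dI d c :=
  le_csSup (finite_dI d c).bddAbove ⟨k, A, B, hA, hB, hAB, hk, rfl⟩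

lemma dI_nonneg (hd : ∀ i j, 0 ≤ d i j) : 0 ≤ dI d c := by
  refine Real.sSup_nonneg ?_
  rintro r ⟨k, A, B, -, -, -, -, rfl⟩
  refine Real.sInf_nonneg ?_
  rintro r ⟨i, -, j, -, rfl⟩
  exact hd i j

end Distances

/-! ### Single linkage clustering recovers the true clusters -/

section Slink

variable {M K : ℕ} {d e : Fin M → Fin M → ℝ} {c : Fin M → Fin K}
  {tie : Finset (Finset (Fin M) × Finset (Fin M)) → Finset (Fin M) × Finset (Fin M)}

/-- `𝒞` is a partition of the index set that refines the true clustering given by `c`. -/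
structure IsRefinement (c : Fin M → Fin K) (𝒞 : Finset (Finset (Fin M))) : Prop where
  nonempty : ∀ A ∈ 𝒞, A.Nonempty
  disjoint : ∀ A ∈ 𝒞, ∀ B ∈ 𝒞, A ≠ B → Disjoint A B
  cover : ∀ i, ∃ A ∈ 𝒞, i ∈ A
  constant : ∀ A ∈ 𝒞, ∀ i ∈ A, ∀ j ∈ A, c i = c j

lemma isRefinement_singletons (c : Fin M → Fin K) :
    IsRefinement c (Finset.univ.image fun i => {i}) where
  nonempty := by simp
  disjoint := by
    simp only [Finset.mem_image, Finset.mem_univ, true_and]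
    rintro _ ⟨i, rfl⟩ _ ⟨j, rfl⟩ hij
    simpa using hij
  cover i := ⟨{i}, by simp, by simp⟩
  constant := by
    simp only [Finset.mem_image, Finset.mem_univ, true_and]
    rintro _ ⟨i, rfl⟩ j hj l hl
    rw [Finset.mem_singleton.1 hj, Finset.mem_singleton.1 hl]

/-- A refinement of the true clustering with as many clusters is the true clustering. -/
lemma IsRefinement.eq_trueClusters {𝒞 : Finset (Finset (Fin M))} (h : IsRefinement c 𝒞)
    (hc : Function.Surjective c) (hcard : 𝒞.card = K) : 𝒞 = trueClusters c := by
  choose f hf using h.nonempty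
  let g : 𝒞 → Fin K := fun A => c (f A A.2)
  have hg (A : 𝒞) {i : Fin M} (hi : i ∈ A.1) : g A = c i := h.constant A A.2 _ (hf A A.2) i hi
  have hsurj : Function.Surjective g := by
    intro k
    obtain ⟨i, rfl⟩ := hc k
    obtain ⟨A, hA, hi⟩ := h.cover i
    exact ⟨⟨A, hA⟩, hg ⟨A, hA⟩ hi⟩
  have hinj : Function.Injective g :=
    ((Fintype.bijective_iff_surjective_and_card g).2 ⟨hsurj, by simp [hcard]⟩).1
  refine Finset.eq_of_subset_of_card_le (fun A hA => ?_) (by rw [card_trueClusters hc, hcard])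
  refine mem_trueClusters.2 ⟨g ⟨A, hA⟩, ?_⟩
  ext j
  rw [mem_cluster]
  refine ⟨fun hj => ?_, fun hj => (hg ⟨A, hA⟩ hj).symm⟩
  obtain ⟨B, hB, hjB⟩ := h.cover j
  have : (⟨B, hB⟩ : 𝒞) = ⟨A, hA⟩ := hinj ((hg ⟨B, hB⟩ hjB).trans hj)
  rwa [Subtype.mk.inj this] at hjB

/-- While there are more clusters than true clusters, two of them lie in the same true cluster, so
some pair of clusters is at distance at most `d_I`. -/
lemma IsRefinement.exists_le_dI {𝒞 : Finset (Finset (Fin M))} (h : IsRefinement c 𝒞)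
    (hcard : K < 𝒞.card) :
    ∃ A ∈ 𝒞, ∃ B ∈ 𝒞, A ≠ B ∧ ∃ i ∈ A, ∃ j ∈ B, d i j ≤ dI d c := by
  choose f hf using h.nonempty
  obtain ⟨A, B, hAB, hfAB⟩ := Fintype.exists_ne_map_eq_of_card_lt (fun A : 𝒞 => c (f A A.2))
    (by simpa using hcard)
  have hAB' : A.1 ≠ B.1 := fun h => hAB (Subtype.ext h)
  have hsub : A.1 ⊆ cluster c (c (f A A.2)) := fun i hi =>
    mem_cluster.2 (h.constant A A.2 i hi _ (hf A A.2))
  have hne : (cluster c (c (f A A.2)) \ A.1).Nonempty := by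
    refine ⟨f B B.2, Finset.mem_sdiff.2 ⟨mem_cluster.2 hfAB.symm, fun hmem => ?_⟩⟩
    exact Finset.disjoint_left.1 (h.disjoint A A.2 B B.2 hAB') hmem (hf B B.2)
  have hle := setDist_le_dI (d := d) (h.nonempty A A.2) hne Finset.disjoint_sdiff
    (Finset.union_sdiff_of_subset hsub)
  obtain ⟨i, hi, j, hj, hij⟩ := exists_setDist_eq (d := d) (h.nonempty A A.2) hne
  obtain ⟨B', hB', hjB'⟩ := h.cover j
  refine ⟨A, A.2, B', hB', ?_, i, hi, j, hjB', hij ▸ hle⟩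
  rintro rfl
  exact (Finset.mem_sdiff.1 hj).2 hjB'

lemma mem_closestPairs {𝒞 : Finset (Finset (Fin M))} {q : Finset (Fin M) × Finset (Fin M)} :
    q ∈ closestPairs d 𝒞 ↔
      (q.1 ∈ 𝒞 ∧ q.2 ∈ 𝒞 ∧ q.1 ≠ q.2) ∧ setDist d q.1 q.2 = interDist d 𝒞 := by
  simp [closestPairs, Finset.mem_offDiag]

/-- Merging two clusters of a refinement that lie in the same true cluster. -/
lemma IsRefinement.merge {𝒞 : Finset (Finset (Fin M))} (h : IsRefinement c 𝒞)
    {A B : Finset (Fin M)} (hA : A ∈ 𝒞) (hB : B ∈ 𝒞) (hAB : A ≠ B) {i j : Fin M} (hi : i ∈ A)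
    (hj : j ∈ B) (hij : c i = c j) :
    IsRefinement c (insert (A ∪ B) ((𝒞.erase A).erase B)) ∧
      (insert (A ∪ B) ((𝒞.erase A).erase B)).card + 1 = 𝒞.card := by
  have hdisj : ∀ D ∈ (𝒞.erase A).erase B, Disjoint (A ∪ B) D := by
    intro D hD
    simp only [Finset.mem_erase] at hD
    exact Finset.disjoint_union_left.2
      ⟨h.disjoint A hA D hD.2.2 (Ne.symm hD.2.1), h.disjoint B hB D hD.2.2 (Ne.symm hD.1)⟩
  have hmem : ∀ D ∈ (𝒞.erase A).erase B, D ∈ 𝒞 := fun D hD =>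
    Finset.mem_of_mem_erase (Finset.mem_of_mem_erase hD)
  have hne : (A ∪ B).Nonempty := ⟨i, Finset.mem_union_left _ hi⟩
  refine ⟨⟨?_, ?_, ?_, ?_⟩, ?_⟩
  · intro D hD
    rcases Finset.mem_insert.1 hD with rfl | hD
    · exact hne
    · exact h.nonempty D (hmem D hD)
  · intro D hD E hE hDE
    rcases Finset.mem_insert.1 hD with rfl | hD <;> rcases Finset.mem_insert.1 hE with rfl | hE
    · exact absurd rfl hDE
    · exact hdisj E hE
    · exact (hdisj D hD).symm
    · exact h.disjoint D (hmem D hD) E (hmem E hE) hDE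
  · intro l
    obtain ⟨D, hD, hl⟩ := h.cover l
    by_cases hDA : D = A
    · exact ⟨A ∪ B, Finset.mem_insert_self _ _, Finset.mem_union_left _ (hDA ▸ hl)⟩
    by_cases hDB : D = B
    · exact ⟨A ∪ B, Finset.mem_insert_self _ _, Finset.mem_union_right _ (hDB ▸ hl)⟩
    exact ⟨D, Finset.mem_insert_of_mem (Finset.mem_erase.2 ⟨hDB, Finset.mem_erase.2 ⟨hDA, hD⟩⟩), hl⟩
  · have hconst : ∀ l ∈ A ∪ B, c l = c i := by
      intro l hl
      rcases Finset.mem_union.1 hl with hl | hl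
      · exact h.constant A hA l hl i hi
      · exact (h.constant B hB l hl j hj).trans hij.symm
    intro D hD l hl m hm
    rcases Finset.mem_insert.1 hD with rfl | hD
    · rw [hconst l hl, hconst m hm]
    · exact h.constant D (hmem D hD) l hl m hm
  · have hnot : A ∪ B ∉ (𝒞.erase A).erase B := fun hD =>
      hne.ne_empty (disjoint_self.1 (hdisj _ hD))
    have hB' : B ∈ 𝒞.erase A := Finset.mem_erase.2 ⟨hAB.symm, hB⟩
    rw [Finset.card_insert_of_notMem hnot, Finset.card_erase_add_one hB',
      Finset.card_erase_add_one hA]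

/-- If the distances `e` are closer to `d` than half the gap between `d_I` and `d_H`, then a step of
single linkage clustering merges two clusters that lie in the same true cluster. -/
lemma IsRefinement.slinkStep (htie : IsTieBreak tie) {ε : ℝ}
    (he : ∀ i j, |e i j - d i j| ≤ ε) (hε : 2 * ε < dH d c - dI d c)
    {𝒞 : Finset (Finset (Fin M))} (h : IsRefinement c 𝒞) (hcard : K < 𝒞.card) :
    IsRefinement c (slinkStep tie e 𝒞) ∧ (slinkStep tie e 𝒞).card + 1 = 𝒞.card := by
  obtain ⟨A, hA, B, hB, hAB, i, hi, j, hj, hij⟩ := h.exists_le_dI (d := d) hcard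
  have hlt : 1 < 𝒞.card := Finset.one_lt_card.2 ⟨A, hA, B, hB, hAB⟩
  have hne : (closestPairs e 𝒞).Nonempty := by
    obtain ⟨A', hA', B', hB', hAB', hq⟩ := exists_interDist_eq (d := e) hlt
    exact ⟨(A', B'), mem_closestPairs.2 ⟨⟨hA', hB', hAB'⟩, hq.symm⟩⟩
  obtain ⟨⟨hq1, hq2, hq⟩, hqd⟩ := mem_closestPairs.1 (htie _ hne)
  obtain ⟨k, hk, l, hl, hkl⟩ := exists_setDist_eq (d := e) (h.nonempty _ hq1) (h.nonempty _ hq2)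
  have hle : interDist e 𝒞 ≤ e i j := (interDist_le hA hB hAB).trans (setDist_le hi hj)
  refine h.merge hq1 hq2 hq hk hl ?_
  by_contra hc
  have h1 := dH_le (d := d) hc
  have h2 := abs_le.1 (he i j)
  have h3 := abs_le.1 (he k l)
  linarith

/-- Single linkage clustering recovers the true clusters from distances that are closer to the true
ones than half the gap between `d_I` and `d_H`. -/
theorem slink_eq_trueClusters (htie : IsTieBreak tie) (hc : Function.Surjective c) {ε : ℝ}
    (he : ∀ i j, |e i j - d i j| ≤ ε) (hε : 2 * ε < dH d c - dI d c) :
    slink K tie e = trueClusters c := by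
  have hKM : K ≤ M := by simpa using Fintype.card_le_of_surjective c hc
  have hiter : ∀ t ≤ M - K, IsRefinement c
      ((SlinkSeq.slinkStep tie e)^[t] (Finset.univ.image fun i => {i})) ∧
      ((SlinkSeq.slinkStep tie e)^[t] (Finset.univ.image fun i => {i})).card + t = M := by
    intro t
    induction t with
    | zero =>
      intro _
      refine ⟨isRefinement_singletons c, ?_⟩
      simp [Finset.card_image_of_injective _ Finset.singleton_injective]
    | succ t ih =>
      intro ht
      obtain ⟨h1, h2⟩ := ih (by omega)
      obtain ⟨h3, h4⟩ := h1.slinkStep htie he hε (by omega)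
      rw [Function.iterate_succ_apply']
      exact ⟨h3, by omega⟩
  obtain ⟨h1, h2⟩ := hiter (M - K) le_rfl
  exact h1.eq_trueClusters hc (by omega)

/-- The minimum inter-cluster distance of the output of single linkage clustering is as close to
`d_H` as the distances are to the true ones. -/
theorem abs_interDist_slink_sub_dH_le (hK : 2 ≤ K) (htie : IsTieBreak tie)
    (hc : Function.Surjective c) {ε : ℝ} (he : ∀ i j, |e i j - d i j| ≤ ε)
    (hε : 2 * ε < dH d c - dI d c) : |interDist e (slink K tie e) - dH d c| ≤ ε := by
  have hcard : 1 < (trueClusters c).card := by rw [card_trueClusters hc]; omega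
  have hne : ∀ A ∈ trueClusters c, A.Nonempty := fun A => nonempty_of_mem_trueClusters hc
  rw [slink_eq_trueClusters htie hc he hε, dH, abs_le]
  have h1 := interDist_le_add (d := e) (e := d) (ε := ε)
    (fun i j => by linarith [(abs_le.1 (he i j)).2]) hne hcard
  have h2 := interDist_le_add (d := d) (e := e) (ε := ε)
    (fun i j => by linarith [(abs_le.1 (he i j)).1]) hne hcard
  constructor <;> linarith

end Slink

/-! ### Measurability of the stopping time -/

section Measurability

variable {M K : ℕ}
  {tie : Finset (Finset (Fin M) × Finset (Fin M)) → Finset (Fin M) × Finset (Fin M)}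

lemma measurable_setDist (A B : Finset (Fin M)) :
    Measurable fun d : Fin M → Fin M → ℝ => setDist d A B := by
  have h (d : Fin M → Fin M → ℝ) : setDist d A B = ⨅ q : A × B, d q.1 q.2 := by
    rw [setDist, iInf]
    congr 1
    ext r
    constructor
    · rintro ⟨i, hi, j, hj, rfl⟩
      exact ⟨(⟨i, hi⟩, ⟨j, hj⟩), rfl⟩
    · rintro ⟨q, rfl⟩
      exact ⟨q.1, q.1.2, q.2, q.2.2, rfl⟩
  simp_rw [h]
  exact Measurable.iInf fun q => by fun_prop

lemma measurable_interDist (𝒞 : Finset (Finset (Fin M))) :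
    Measurable fun d : Fin M → Fin M → ℝ => interDist d 𝒞 := by
  have h (d : Fin M → Fin M → ℝ) : interDist d 𝒞 =
      ⨅ q : {q : Finset (Fin M) × Finset (Fin M) // q.1 ∈ 𝒞 ∧ q.2 ∈ 𝒞 ∧ q.1 ≠ q.2},
        setDist d q.1.1 q.1.2 := by
    rw [interDist, iInf]
    congr 1
    ext r
    constructor
    · rintro ⟨A, hA, B, hB, hAB, rfl⟩
      exact ⟨⟨(A, B), hA, hB, hAB⟩, rfl⟩
    · rintro ⟨q, rfl⟩
      exact ⟨q.1.1, q.2.1, q.1.2, q.2.2.1, q.2.2.2, rfl⟩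
  simp_rw [h]
  exact Measurable.iInf fun q => measurable_setDist _ _

/-- The sets of pairs of clusters and the clusterings form finite types, which carry the discrete
σ-algebra here. -/
lemma measurable_closestPairs (𝒞 : Finset (Finset (Fin M))) :
    Measurable[_, ⊤] fun d : Fin M → Fin M → ℝ => closestPairs d 𝒞 := by
  let _ : MeasurableSpace (Finset (Finset (Fin M) × Finset (Fin M))) := ⊤
  refine measurable_to_countable' fun S => ?_
  have : (fun d : Fin M → Fin M → ℝ => closestPairs d 𝒞) ⁻¹' {S} =
      ⋂ q, {d | q ∈ closestPairs d 𝒞 ↔ q ∈ S} := by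
    ext d
    simp [Finset.ext_iff]
  rw [this]
  refine MeasurableSet.iInter fun q => ?_
  simp_rw [mem_closestPairs]
  exact (((MeasurableSet.const _).inter
    (measurableSet_eq_fun (measurable_setDist _ _) (measurable_interDist _)))).iff
      (MeasurableSet.const _)

lemma measurable_slink (K : ℕ) :
    Measurable[_, ⊤] fun d : Fin M → Fin M → ℝ => slink K tie d := by
  let _ : MeasurableSpace (Finset (Finset (Fin M))) := ⊤
  let _ : MeasurableSpace (Finset (Finset (Fin M) × Finset (Fin M))) := ⊤
  have hstep (𝒞 : Finset (Finset (Fin M))) :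
      Measurable fun d : Fin M → Fin M → ℝ => slinkStep tie d 𝒞 :=
    (measurable_from_top (f := fun S => insert ((tie S).1 ∪ (tie S).2)
      ((𝒞.erase (tie S).1).erase (tie S).2))).comp (measurable_closestPairs 𝒞)
  unfold slink
  induction M - K with
  | zero => exact measurable_const
  | succ t ih =>
    simp_rw [Function.iterate_succ_apply']
    refine measurable_to_countable' fun 𝒟 => ?_
    have : (fun d : Fin M → Fin M → ℝ => slinkStep tie d
        ((slinkStep tie d)^[t] (Finset.univ.image fun i => {i}))) ⁻¹' {𝒟} =
        ⋃ 𝒞, ((fun d => (slinkStep tie d)^[t] (Finset.univ.image fun i => {i})) ⁻¹' {𝒞}) ∩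
          ((fun d => slinkStep tie d 𝒞) ⁻¹' {𝒟}) := by
      ext d
      simp
    rw [this]
    exact MeasurableSet.iUnion fun 𝒞 => (ih trivial).inter (hstep 𝒞 trivial)

lemma measurable_interDist_slink (K : ℕ) :
    Measurable fun d : Fin M → Fin M → ℝ => interDist d (slink K tie d) := by
  let _ : MeasurableSpace (Finset (Finset (Fin M))) := ⊤
  intro s hs
  have : (fun d : Fin M → Fin M → ℝ => interDist d (slink K tie d)) ⁻¹' s =
      ⋃ 𝒞, ((fun d => slink K tie d) ⁻¹' {𝒞}) ∩ ((fun d => interDist d 𝒞) ⁻¹' s) := by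
    ext d
    simp
  rw [this]
  exact MeasurableSet.iUnion fun 𝒞 => (measurable_slink K trivial).inter (measurable_interDist 𝒞 hs)

theorem measurable_stoppingTime {Ω : Type*} [MeasurableSpace Ω] {dhat : ℕ → Ω → Fin M → Fin M → ℝ}
    (hd : ∀ n i j, Measurable fun ω => dhat n ω i j) (C : ℝ) :
    Measurable fun ω => stoppingTime K tie (fun n => dhat n ω) C := by
  have hle (m : ℕ) : MeasurableSet {ω | stoppingTime K tie (fun n => dhat n ω) C < m} := by
    have : {ω | stoppingTime K tie (fun n => dhat n ω) C < m} = ⋃ n : ℕ,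
        {ω | (2 ≤ n ∧ n < m) ∧
          C / Real.sqrt n ≤ interDist (dhat n ω) (slink K tie (dhat n ω))} := by
      ext ω
      simp only [stoppingTime, iInf_lt_iff, Set.mem_ofPred_eq, Set.mem_iUnion, Nat.cast_lt,
        exists_prop]
      exact exists_congr fun n => by tauto
    rw [this]
    refine MeasurableSet.iUnion fun n => (MeasurableSet.const _).inter ?_
    refine measurableSet_le measurable_const ((measurable_interDist_slink K).comp ?_)
    exact measurable_pi_lambda _ fun i => measurable_pi_lambda _ fun j => hd n i j
  refine ENat.measurable_iff.2 fun m => ?_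
  have : (fun ω => stoppingTime K tie (fun n => dhat n ω) C) ⁻¹' {(m : ℕ∞)} =
      {ω | stoppingTime K tie (fun n => dhat n ω) C < (m + 1 : ℕ)} \
        {ω | stoppingTime K tie (fun n => dhat n ω) C < m} := by
    ext ω
    simp only [Set.mem_preimage, Set.mem_singleton_iff, Set.mem_sdiff, Set.mem_ofPred_eq, not_lt,
      Nat.cast_add, Nat.cast_one, ENat.lt_natCast_add_one_iff]
    exact le_antisymm_iff
  rw [this]
  exact (hle _).diff (hle _)

end Measurability

/-! ### The mean deviation of the stopping time -/

/-- If `Γ n` is within `ε` of `D` for all `n > s`, then the first `n ≥ 2` with `Γ n ≥ C / √n` is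
close to `C ^ 2 / D ^ 2`, with an error that is linear in `s`. -/
lemma exists_stopping_eq_abs_sub_le {Γ : ℕ → ℝ} {D ε B C s : ℝ} (hε : 0 < ε) (hεD : ε < D)
    (hC : 0 < C) (hB : ∀ n, Γ n ≤ B) (hs : 0 ≤ s) (hgood : ∀ n : ℕ, s < n → |Γ n - D| ≤ ε) :
    ∃ m : ℕ, (⨅ n : ℕ, ⨅ _ : 2 ≤ n ∧ C / Real.sqrt n ≤ Γ n, (n : ℕ∞)) = m ∧
      |m / C ^ 2 - 1 / D ^ 2| ≤ ((1 / (D - ε) ^ 2 - 1 / D ^ 2) + (1 / D ^ 2 - 1 / (D + ε) ^ 2)) +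
        ((1 + B ^ 2 / D ^ 2) * s + 2) / C ^ 2 := by
  classical
  have hD : 0 < D := hε.trans hεD
  have hDε : 0 < D - ε := sub_pos.2 hεD
  set n₁ : ℕ := max 2 (max ⌈C ^ 2 / (D - ε) ^ 2⌉₊ (⌊s⌋₊ + 1)) with hn₁
  have hx : 0 ≤ C ^ 2 / (D - ε) ^ 2 := by positivity
  have hn₁le : (n₁ : ℝ) ≤ C ^ 2 / (D - ε) ^ 2 + s + 2 := by
    have h1 := (Nat.ceil_lt_add_one hx).le
    have h2 := Nat.floor_le hs
    simp only [hn₁, Nat.cast_max, Nat.cast_add, Nat.cast_one, Nat.cast_ofNat]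
    refine max_le (by linarith) (max_le (by linarith) (by linarith))
  have hsn₁ : s < n₁ := (Nat.lt_floor_add_one s).trans_le
    (by exact_mod_cast (le_max_right _ _).trans (le_max_right _ _))
  have hxn₁ : C ^ 2 / (D - ε) ^ 2 ≤ n₁ := (Nat.le_ceil _).trans
    (by exact_mod_cast (le_max_left _ _).trans (le_max_right _ _))
  have hiff {n : ℕ} (hn : 2 ≤ n) {b : ℝ} (hb : 0 < b) :
      C / Real.sqrt n ≤ b ↔ C ^ 2 / b ^ 2 ≤ n := by
    have hn0 : (0 : ℝ) < n := by exact_mod_cast (by omega : 0 < n)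
    rw [div_le_iff₀ (Real.sqrt_pos.2 hn0), div_le_iff₀ (by positivity),
      ← pow_le_pow_iff_left₀ hC.le (by positivity) two_ne_zero, mul_pow, Real.sq_sqrt hn0.le,
      mul_comm]
  have hΓ := abs_le.1 (hgood n₁ hsn₁)
  have hP : ∃ n : ℕ, 2 ≤ n ∧ C / Real.sqrt n ≤ Γ n :=
    ⟨n₁, le_max_left _ _, ((hiff (le_max_left _ _) hDε).2 hxn₁).trans (by linarith)⟩
  obtain ⟨hm2, hmΓ⟩ := Nat.find_spec hP
  have hmle : Nat.find hP ≤ n₁ := Nat.find_min' hP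
    ⟨le_max_left _ _, ((hiff (le_max_left _ _) hDε).2 hxn₁).trans (by linarith)⟩
  refine ⟨Nat.find hP, le_antisymm (iInf_le_of_le _ (iInf_le _ (Nat.find_spec hP)))
    (le_iInf₂ fun n hn => by exact_mod_cast Nat.find_min' hP hn), ?_⟩
  set m := Nat.find hP
  have hm0 : (0 : ℝ) < m := by exact_mod_cast (by omega : 0 < m)
  have hC2 : 0 < C ^ 2 := by positivity
  have hδ₁ : 0 ≤ 1 / (D - ε) ^ 2 - 1 / D ^ 2 :=
    sub_nonneg.2 (one_div_le_one_div_of_le (by positivity)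
      (pow_le_pow_left₀ hDε.le (by linarith) 2))
  have hδ₂ : 0 ≤ 1 / D ^ 2 - 1 / (D + ε) ^ 2 :=
    sub_nonneg.2 (one_div_le_one_div_of_le (by positivity)
      (pow_le_pow_left₀ hD.le (by linarith) 2))
  have hs1 : 0 ≤ (s + 2) / C ^ 2 := by positivity
  have hs2 : 0 ≤ B ^ 2 / D ^ 2 * s / C ^ 2 := by positivity
  have hsplit : ((1 + B ^ 2 / D ^ 2) * s + 2) / C ^ 2 =
      (s + 2) / C ^ 2 + B ^ 2 / D ^ 2 * s / C ^ 2 := by ring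
  rw [hsplit, abs_le]
  constructor
  -- Either `m > s`, and then `C / √m ≤ D + ε`, or `s ≥ m ≥ C ^ 2 / B ^ 2`.
  · rcases lt_or_ge s m with hsm | hsm
    · have h1 := (hiff hm2 (by linarith : 0 < D + ε)).1
        (hmΓ.trans (by linarith [(abs_le.1 (hgood m hsm)).2]))
      have h2 : 1 / (D + ε) ^ 2 ≤ m / C ^ 2 := by
        rw [le_div_iff₀ hC2]
        calc _ = C ^ 2 / (D + ε) ^ 2 := by ring
          _ ≤ _ := h1
      linarith
    · have hCB : C / Real.sqrt m ≤ B := hmΓ.trans (hB m)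
      have hB0 : 0 < B := (div_pos hC (Real.sqrt_pos.2 hm0)).trans_le hCB
      have h1 := ((hiff hm2 hB0).1 hCB).trans hsm
      have h2 : 1 / D ^ 2 ≤ B ^ 2 / D ^ 2 * s / C ^ 2 := by
        rw [div_le_iff₀ (by positivity)] at h1
        rw [le_div_iff₀ hC2, div_mul_eq_mul_div, div_mul_eq_mul_div]
        exact div_le_div_of_nonneg_right (by linarith) (by positivity)
      have h3 : 0 ≤ m / C ^ 2 := by positivity
      linarith
  · have h1 : (m : ℝ) ≤ C ^ 2 / (D - ε) ^ 2 + (s + 2) := by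
      have : (m : ℝ) ≤ n₁ := by exact_mod_cast hmle
      linarith
    have h2 : m / C ^ 2 ≤ 1 / (D - ε) ^ 2 + (s + 2) / C ^ 2 := by
      rw [div_le_iff₀ hC2, add_mul, div_mul_cancel₀ _ hC2.ne']
      calc _ ≤ _ := h1
        _ = _ := by ring
    linarith

section MeanDeviation

variable {Ω : Type*} [MeasurableSpace Ω] {μ : Measure Ω} [IsProbabilityMeasure μ] {M K : ℕ}
  {c : Fin M → Fin K} {d : Fin M → Fin M → ℝ} {dhat : ℕ → Ω → Fin M → Fin M → ℝ}
  {tie : Finset (Finset (Fin M) × Finset (Fin M)) → Finset (Fin M) × Finset (Fin M)}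

/-- The event `E n` that an estimate from `n` samples is off by more than `ε` contributes `n` to
`∑ n, n * 1_{E n}`, so this sum bounds the last such `n`. -/
lemma meanDeviation_le (hK : 2 ≤ K) (hc : Function.Surjective c) (htie : IsTieBreak tie)
    (hd : ∀ i j, 0 ≤ d i j) {B : ℝ} (hB0 : 0 ≤ B) (hB : ∀ n ω i j, dhat n ω i j ≤ B)
    {ε : ℝ} (hε : 0 < ε) (hgap : 2 * ε < dH d c - dI d c) {E : ℕ → Set Ω}
    (hE : ∀ n, 0 < n → ∀ ω ∉ E n, ∀ i j, |dhat n ω i j - d i j| ≤ ε) {C : ℝ} (hC : 0 < C) :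
    meanDeviation μ (fun ω => stoppingTime K tie (fun n => dhat n ω) C) C (1 / dH d c ^ 2) ≤
      ENNReal.ofReal ((1 / (dH d c - ε) ^ 2 - 1 / dH d c ^ 2) +
        (1 / dH d c ^ 2 - 1 / (dH d c + ε) ^ 2)) +
      (ENNReal.ofReal (1 + B ^ 2 / dH d c ^ 2) * ∑' n : ℕ, n * μ (E n) + 2) /
        ENNReal.ofReal (C ^ 2) := by
  set D := dH d c
  have hεD : ε < D := by linarith [dI_nonneg (c := c) hd]
  have hD : 0 < D := hε.trans hεD
  have hC2 : 0 < C ^ 2 := by positivity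
  set δ := (1 / (D - ε) ^ 2 - 1 / D ^ 2) + (1 / D ^ 2 - 1 / (D + ε) ^ 2) with hδdef
  have hδ : 0 ≤ δ := by
    have : 1 / (D + ε) ^ 2 ≤ 1 / (D - ε) ^ 2 :=
      one_div_le_one_div_of_le (pow_pos (sub_pos.2 hεD) 2)
        (pow_le_pow_left₀ (sub_pos.2 hεD).le (by linarith) 2)
    rw [hδdef]
    linarith
  set F : ℕ → Set Ω := fun n => toMeasurable μ (E n)
  have hF (n : ℕ) : MeasurableSet (F n) := measurableSet_toMeasurable μ (E n)
  set S : Ω → ℝ≥0∞ := fun ω => ∑' n : ℕ, (n : ℝ≥0∞) * (F n).indicator 1 ω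
  have hSm : Measurable S := Measurable.tsum fun n =>
    (measurable_one.indicator (hF n)).const_mul _
  have hSint : ∫⁻ ω, S ω ∂μ = ∑' n : ℕ, n * μ (E n) := by
    rw [lintegral_tsum fun n => ((measurable_one.indicator (hF n)).const_mul _).aemeasurable]
    refine tsum_congr fun n => ?_
    rw [lintegral_const_mul _ (measurable_one.indicator (hF n)), lintegral_indicator_one (hF n),
      measure_toMeasurable]
  have hpt (ω : Ω) : (((stoppingTime K tie (fun n => dhat n ω) C : ℝ≥0∞) : EReal) /
      ((C ^ 2 : ℝ) : EReal) - ((1 / D ^ 2 : ℝ) : EReal)).abs ≤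
      ENNReal.ofReal δ +
        (ENNReal.ofReal (1 + B ^ 2 / D ^ 2) * S ω + 2) / ENNReal.ofReal (C ^ 2) := by
    by_cases hSω : S ω = ⊤
    · have : ENNReal.ofReal (1 + B ^ 2 / D ^ 2) ≠ 0 :=
        (ENNReal.ofReal_pos.2 (by positivity)).ne'
      simp [hSω, ENNReal.mul_top this, ENNReal.top_div_of_ne_top]
    obtain ⟨m, hm, hle⟩ := exists_stopping_eq_abs_sub_le (C := C)
      (Γ := fun n => interDist (dhat n ω) (slink K tie (dhat n ω))) (D := D) (s := (S ω).toReal)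
      hε hεD hC (fun n => interDist_le_of_forall_le hB0 (hB n ω) _) ENNReal.toReal_nonneg
      (fun n hn => by
        have hn0 : 0 < n := by exact_mod_cast ENNReal.toReal_nonneg.trans_lt hn
        refine abs_interDist_slink_sub_dH_le hK htie hc (hE n hn0 ω fun hω => ?_) hgap
        have h1 : (n : ℝ≥0∞) ≤ S ω := by
          have := ENNReal.le_tsum (f := fun n : ℕ => (n : ℝ≥0∞) * (F n).indicator 1 ω) n
          rwa [Set.indicator_of_mem (subset_toMeasurable μ (E n) hω : ω ∈ F n), Pi.one_apply,
            mul_one] at this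
        have h2 := ENNReal.toReal_mono hSω h1
        rw [ENNReal.toReal_natCast] at h2
        exact absurd hn h2.not_gt)
    change _ ≤ δ + _ at hle
    rw [stoppingTime, hm]
    have hreal : (((((m : ℕ∞) : ℝ≥0∞) : EReal) / ((C ^ 2 : ℝ) : EReal) -
        ((1 / D ^ 2 : ℝ) : EReal))) = ((m / C ^ 2 - 1 / D ^ 2 : ℝ) : EReal) := by
      rw [EReal.coe_sub, EReal.coe_div]
      rfl
    rw [hreal, EReal.abs_def]
    refine (ENNReal.ofReal_le_ofReal hle).trans ?_
    have hSnn : 0 ≤ (1 + B ^ 2 / D ^ 2) * (S ω).toReal := by positivity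
    rw [ENNReal.ofReal_add hδ (by positivity), ENNReal.ofReal_div_of_pos hC2,
      ENNReal.ofReal_add hSnn (by norm_num), ENNReal.ofReal_mul (by positivity),
      ENNReal.ofReal_toReal hSω, ENNReal.ofReal_ofNat]
  refine (lintegral_mono hpt).trans_eq ?_
  simp only [div_eq_mul_inv]
  rw [lintegral_add_left measurable_const, lintegral_const, measure_univ, mul_one,
    lintegral_mul_const _ ((hSm.const_mul _).add_const _),
    lintegral_add_right _ measurable_const, lintegral_const_mul _ hSm, hSint, lintegral_const,
    measure_univ, mul_one]

/-- The stopping time of the sequential algorithm for arbitrary estimates whose errors satisfy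
`∑ n, n * P(error at n) < ∞`, where the errors are controlled one sequence at a time. -/
theorem tendsto_meanDeviation (hK : 2 ≤ K) (hc : Function.Surjective c) (htie : IsTieBreak tie)
    (hd : ∀ i j, 0 ≤ d i j) (hdH : dI d c < dH d c) {B : ℝ} (hB0 : 0 ≤ B)
    (hB : ∀ n ω i j, dhat n ω i j ≤ B)
    (herr : ∀ ε > 0, ∃ E : Fin M → ℕ → Set Ω, (∀ i, ∑' n : ℕ, n * μ (E i n) ≠ ⊤) ∧
      ∀ n, 0 < n → ∀ ω i j, ω ∉ E i n → ω ∉ E j n → |dhat n ω i j - d i j| ≤ ε) :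
    Tendsto (fun C : ℝ => meanDeviation μ
      (fun ω => stoppingTime K tie (fun n => dhat n ω) C) C (1 / dH d c ^ 2)) atTop (𝓝 0) := by
  set D := dH d c
  have hD : 0 < D := (dI_nonneg (c := c) hd).trans_lt hdH
  have hlim : Tendsto (fun ε : ℝ => ENNReal.ofReal ((1 / (D - ε) ^ 2 - 1 / D ^ 2) +
      (1 / D ^ 2 - 1 / (D + ε) ^ 2))) (𝓝[>] 0) (𝓝 0) := by
    have hcont : ContinuousAt (fun ε : ℝ => (1 / (D - ε) ^ 2 - 1 / D ^ 2) +
      (1 / D ^ 2 - 1 / (D + ε) ^ 2)) 0 := by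
      have h1 : (D - 0) ^ 2 ≠ 0 := by simpa using hD.ne'
      have h2 : (D + 0) ^ 2 ≠ 0 := by simpa using hD.ne'
      fun_prop (disch := assumption)
    have := (ENNReal.continuous_ofReal.tendsto _).comp hcont.tendsto
    simp only [sub_zero, add_zero, sub_self, ENNReal.ofReal_zero] at this
    exact this.mono_left nhdsWithin_le_nhds
  rw [ENNReal.tendsto_nhds_zero] at hlim ⊢
  intro η hη
  have hη2 : 0 < η / 2 := ENNReal.half_pos hη.ne'
  obtain ⟨ε, hεη, hε, hgap⟩ := ((hlim _ hη2).and (Ioo_mem_nhdsGT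
    (by linarith : 0 < (D - dI d c) / 2))).exists
  obtain ⟨E, hEsum, hE⟩ := herr ε hε
  have hsum : ∑' n : ℕ, n * μ (⋃ i, E i n) ≠ ⊤ := by
    refine ne_top_of_le_ne_top (ENNReal.sum_ne_top.2 fun i _ => hEsum i) (?_ : _ ≤ ∑ i, _)
    rw [← Summable.tsum_finsetSum fun i _ => ENNReal.summable]
    refine ENNReal.tsum_le_tsum fun n => ?_
    rw [← Finset.mul_sum]
    gcongr
    exact measure_iUnion_fintype_le _ _
  have hlim2 : Tendsto (fun C : ℝ => (ENNReal.ofReal (1 + B ^ 2 / D ^ 2) *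
      ∑' n : ℕ, n * μ (⋃ i, E i n) + 2) / ENNReal.ofReal (C ^ 2)) atTop (𝓝 0) := by
    have h1 : Tendsto (fun C : ℝ => ENNReal.ofReal (C ^ 2)) atTop (𝓝 ⊤) :=
      ENNReal.tendsto_ofReal_atTop.comp (tendsto_pow_atTop two_ne_zero)
    have h2 := ENNReal.Tendsto.const_div h1 (a := ENNReal.ofReal (1 + B ^ 2 / D ^ 2) *
      ∑' n : ℕ, n * μ (⋃ i, E i n) + 2) (Or.inr (by finiteness))
    simpa using h2
  filter_upwards [ENNReal.tendsto_nhds_zero.1 hlim2 _ hη2, eventually_gt_atTop 0] with C hC hC0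
  refine (meanDeviation_le hK hc htie hd hB0 hB hε (by linarith) (E := fun n => ⋃ i, E i n)
    (fun n hn ω hω i j => ?_) hC0).trans ((add_le_add hεη hC).trans_eq (ENNReal.add_halves η))
  simp only [Set.mem_iUnion, not_exists] at hω
  exact hE n hn ω i j (hω i) (hω j)

end MeanDeviation

/-! ### Concentration of sums over a bounded degenerate kernel -/

section Concentration

variable {Ω 𝒳 : Type*} [MeasurableSpace Ω] [MeasurableSpace 𝒳] {μ : Measure Ω}
  [IsProbabilityMeasure μ] {X : ℕ → Ω → 𝒳} {p : Measure 𝒳}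

/-- Two-sided Hoeffding inequality for a bounded centred function of i.i.d. samples. -/
lemma measure_le_abs_sum_le (hX : ∀ l, Measurable (X l)) (hindep : iIndepFun X μ)
    (hlaw : ∀ l, μ.map (X l) = p) {g : 𝒳 → ℝ} (hg : Measurable g) {B : ℝ} (hB : 0 < B)
    (hgB : ∀ x, |g x| ≤ B) (hg0 : ∫ x, g x ∂p = 0) {s : Finset ℕ} {n : ℕ} (hs : 0 < s.card)
    (hsn : s.card ≤ n) {t : ℝ} (ht : 0 ≤ t) :
    μ {ω | t ≤ |∑ m ∈ s, g (X m ω)|} ≤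
      ENNReal.ofReal (2 * Real.exp (-t ^ 2 / (2 * n * B ^ 2))) := by
  have key (g : 𝒳 → ℝ) (hg : Measurable g) (hgB : ∀ x, |g x| ≤ B) (hg0 : ∫ x, g x ∂p = 0) :
      μ.real {ω | t ≤ ∑ m ∈ s, g (X m ω)} ≤ Real.exp (-t ^ 2 / (2 * n * B ^ 2)) := by
    have hsub : ∀ m ∈ s, HasSubgaussianMGF (fun ω => g (X m ω)) ((‖B - -B‖₊ / 2) ^ 2) μ := by
      intro m _
      refine hasSubgaussianMGF_of_mem_Icc_of_integral_eq_zero (hg.comp (hX m)).aemeasurable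
        (ae_of_all _ fun ω => abs_le.1 (hgB _)) ?_
      rw [← hg0, ← hlaw m, integral_map (hX m).aemeasurable hg.aestronglyMeasurable]
    refine (HasSubgaussianMGF.measure_sum_ge_le_of_iIndepFun
      (hindep.comp (fun _ => g) fun _ => hg) hsub ht).trans ?_
    have hc : (((‖B - -B‖₊ / 2) ^ 2 : NNReal) : ℝ) = B ^ 2 := by
      simp only [sub_neg_eq_add, NNReal.coe_pow, NNReal.coe_div, coe_nnnorm, Real.norm_eq_abs,
        NNReal.coe_ofNat]
      rw [abs_of_pos (by linarith)]
      ring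
    rw [Finset.sum_const, NNReal.coe_nsmul, hc, nsmul_eq_mul, Real.exp_le_exp, neg_div, neg_div,
      neg_le_neg_iff]
    have hs' : (0 : ℝ) < s.card := by exact_mod_cast hs
    have hsn' : (s.card : ℝ) ≤ n := by exact_mod_cast hsn
    refine div_le_div_of_nonneg_left (by positivity) (by positivity) ?_
    rw [mul_assoc]
    gcongr
  have h1 := key g hg hgB hg0
  have h2 := key (fun x => -g x) hg.neg (fun x => by rw [abs_neg]; exact hgB x)
    (by rw [integral_neg, hg0, neg_zero])
  have hsub : {ω | t ≤ |∑ m ∈ s, g (X m ω)|} ⊆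
      {ω | t ≤ ∑ m ∈ s, g (X m ω)} ∪ {ω | t ≤ ∑ m ∈ s, -g (X m ω)} := by
    intro ω hω
    simpa [le_abs, Finset.sum_neg_distrib] using hω
  rw [← ofReal_measureReal]
  refine ENNReal.ofReal_le_ofReal ?_
  calc _ ≤ _ := measureReal_mono hsub
    _ ≤ _ := measureReal_union_le _ _
    _ ≤ _ := by linarith

/-- Hoeffding's inequality conditionally on `X l`: by independence the law of `X l` and of the other
samples is a product, and the bound holds for every value of `X l`. -/
lemma measure_le_abs_sum_kernel_le (hX : ∀ l, Measurable (X l)) (hindep : iIndepFun X μ)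
    (hlaw : ∀ l, μ.map (X l) = p) {h : 𝒳 → 𝒳 → ℝ} (hh : Measurable fun z : 𝒳 × 𝒳 => h z.1 z.2)
    {B : ℝ} (hB : 0 < B) (hhB : ∀ x y, |h x y| ≤ B) (hh0 : ∀ x, ∫ y, h x y ∂p = 0)
    {s : Finset ℕ} {l n : ℕ} (hl : l ∉ s) (hs : 0 < s.card) (hsn : s.card ≤ n) {t : ℝ}
    (ht : 0 ≤ t) :
    μ {ω | t ≤ |∑ m ∈ s, h (X l ω) (X m ω)|} ≤
      ENNReal.ofReal (2 * Real.exp (-t ^ 2 / (2 * n * B ^ 2))) := by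
  have hp : IsProbabilityMeasure p := hlaw 0 ▸ Measure.isProbabilityMeasure_map (hX 0).aemeasurable
  set Y : Ω → s → 𝒳 := fun ω m => X m ω
  have hY : Measurable Y := measurable_pi_lambda _ fun m => hX m
  have hXY : IndepFun (X l) Y μ :=
    (hindep.indepFun_finset {l} s (Finset.disjoint_singleton_left.2 hl) hX).comp
      (measurable_pi_apply (⟨l, Finset.mem_singleton_self l⟩ : ({l} : Finset ℕ))) measurable_id
  set A : Set (𝒳 × (s → 𝒳)) := {z | t ≤ |∑ m : s, h z.1 (z.2 m)|}
  have hA : MeasurableSet A := by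
    refine measurableSet_le measurable_const (Measurable.abs (Finset.measurable_fun_sum _ ?_))
    intro m _
    exact hh.comp (measurable_fst.prodMk ((measurable_pi_apply m).comp measurable_snd))
  have hset : {ω | t ≤ |∑ m ∈ s, h (X l ω) (X m ω)|} = (fun ω => (X l ω, Y ω)) ⁻¹' A := by
    ext ω
    simp only [A, Y, Set.mem_ofPred_eq, Set.mem_preimage]
    rw [Finset.sum_coe_sort s fun m => h (X l ω) (X m ω)]
  have hν : IsProbabilityMeasure (μ.map Y) := Measure.isProbabilityMeasure_map hY.aemeasurable
  rw [hset, ← Measure.map_apply ((hX l).prodMk hY) hA,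
    (indepFun_iff_map_prod_eq_prod_map_map (hX l).aemeasurable hY.aemeasurable).1 hXY, hlaw l,
    Measure.prod_apply hA]
  refine (lintegral_mono (g := fun _ =>
    ENNReal.ofReal (2 * Real.exp (-t ^ 2 / (2 * n * B ^ 2)))) fun x => ?_).trans_eq (by simp)
  rw [Measure.map_apply hY (measurable_prodMk_left hA)]
  have := measure_le_abs_sum_le hX hindep hlaw (hh.comp measurable_prodMk_left) hB (hhB x) (hh0 x)
    hs hsn ht
  refine le_trans (le_of_eq ?_) this
  congr 1
  ext ω
  simp only [A, Y, Set.mem_ofPred_eq, Set.mem_preimage, Function.comp_apply]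
  rw [Finset.sum_coe_sort s fun m => h x (X m ω)]

/-- For a bounded kernel `h` that is degenerate, i.e. `𝔼 h(x, X) = 0` for all `x`, all the averages
`(1 / n) ∑ m, h (X l) (X m)` with `l < n` are small, outside events whose probabilities decay
exponentially in `n`. -/
theorem tsum_mul_measure_exists_lt_ne_top (hX : ∀ l, Measurable (X l)) (hindep : iIndepFun X μ)
    (hlaw : ∀ l, μ.map (X l) = p) {h : 𝒳 → 𝒳 → ℝ} (hh : Measurable fun z : 𝒳 × 𝒳 => h z.1 z.2)
    {B : ℝ} (hB : 0 < B) (hhB : ∀ x y, |h x y| ≤ B) (hh0 : ∀ x, ∫ y, h x y ∂p = 0) {ε : ℝ}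
    (hε : 0 < ε) :
    ∑' n : ℕ, (n : ℝ≥0∞) * μ {ω | ∃ l ∈ Finset.range n,
      n * ε < |∑ m ∈ Finset.range n, h (X l ω) (X m ω)|} ≠ ⊤ := by
  set a : ℝ := ε ^ 2 / (8 * B ^ 2)
  have ha : 0 < a := by positivity
  set n₀ : ℕ := max 2 ⌈2 * B / ε⌉₊
  -- The diagonal term is at most `B ≤ n * ε / 2`, so the other terms sum to at least `n * ε / 2`.
  have hbound (n : ℕ) (hn : n₀ ≤ n) : μ {ω | ∃ l ∈ Finset.range n,
      n * ε < |∑ m ∈ Finset.range n, h (X l ω) (X m ω)|} ≤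
        ENNReal.ofReal (n * (2 * Real.exp (-a * n))) := by
    have hn2 : 2 ≤ n := (le_max_left _ _).trans hn
    have hn0 : (0 : ℝ) < n := by exact_mod_cast (by omega : 0 < n)
    have hnB : B ≤ n * ε / 2 := by
      have h1 : 2 * B / ε ≤ n := (Nat.le_ceil _).trans
        (by exact_mod_cast (le_max_right _ _).trans hn)
      rw [div_le_iff₀ hε] at h1
      linarith
    have hsub : {ω | ∃ l ∈ Finset.range n,
        n * ε < |∑ m ∈ Finset.range n, h (X l ω) (X m ω)|} ⊆ ⋃ l ∈ Finset.range n,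
          {ω | n * ε / 2 ≤ |∑ m ∈ (Finset.range n).erase l, h (X l ω) (X m ω)|} := by
      rintro ω ⟨l, hl, hω⟩
      refine Set.mem_biUnion hl ?_
      rw [← Finset.add_sum_erase _ _ hl] at hω
      have h1 := abs_add_le (h (X l ω) (X l ω))
        (∑ m ∈ (Finset.range n).erase l, h (X l ω) (X m ω))
      have h2 := hhB (X l ω) (X l ω)
      simp only [Set.mem_ofPred_eq]
      linarith
    have hexp : -(n * ε / 2) ^ 2 / (2 * n * B ^ 2) = -a * n := by
      simp only [a]
      field_simp
      ring
    calc _ ≤ _ := measure_mono hsub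
      _ ≤ ∑ l ∈ Finset.range n,
          μ {ω | n * ε / 2 ≤ |∑ m ∈ (Finset.range n).erase l, h (X l ω) (X m ω)|} :=
        measure_biUnion_finset_le _ _
      _ ≤ ∑ l ∈ Finset.range n, ENNReal.ofReal (2 * Real.exp (-a * n)) := by
        refine Finset.sum_le_sum fun l hl => ?_
        have hcard : ((Finset.range n).erase l).card = n - 1 := by
          rw [Finset.card_erase_of_mem hl, Finset.card_range]
        rw [← hexp]
        exact measure_le_abs_sum_kernel_le hX hindep hlaw hh hB hhB hh0
          (Finset.notMem_erase l _) (by omega) (by omega) (by positivity)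
      _ = _ := by
        rw [Finset.sum_const, Finset.card_range, nsmul_eq_mul, ENNReal.ofReal_mul hn0.le,
          ENNReal.ofReal_natCast]
  have hsum : Summable fun n : ℕ => (if n < n₀ then (n : ℝ) else 0) +
      2 * ((n : ℝ) ^ 2 * Real.exp (-a * n)) := by
    refine Summable.add (summable_of_hasFiniteSupport
      ((Set.finite_lt_nat n₀).subset fun n hn => ?_))
      ((Real.summable_pow_mul_exp_neg_nat_mul 2 ha).mul_left 2)
    by_contra hlt
    exact hn (if_neg hlt)
  refine ne_top_of_le_ne_top hsum.tsum_ofReal_ne_top (ENNReal.tsum_le_tsum fun n => ?_)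
  rcases lt_or_ge n n₀ with hn | hn
  · rw [if_pos hn, ENNReal.ofReal_add (by positivity) (by positivity), ENNReal.ofReal_natCast]
    exact (mul_le_of_le_one_right' prob_le_one).trans le_self_add
  · rw [if_neg hn.not_gt, zero_add]
    refine (mul_le_mul_right (hbound n hn) _).trans_eq ?_
    rw [← ENNReal.ofReal_natCast n, ← ENNReal.ofReal_mul (by positivity)]
    congr 1
    ring

end Concentration

/-! ### Kolmogorov-Smirnov distance -/

section KS

lemma empCdf_eq_sum (n : ℕ) (x : ℕ → ℝ) (a : ℝ) :
    empCdf n x a = (1 / (n : ℝ)) * ∑ l ∈ Finset.range n, if x l ≤ a then (1 : ℝ) else 0 := by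
  simp [empCdf, Set.indicator_apply]

lemma empCdf_nonneg (n : ℕ) (x : ℕ → ℝ) (a : ℝ) : 0 ≤ empCdf n x a := by
  rw [empCdf_eq_sum]
  exact mul_nonneg (by positivity) (Finset.sum_nonneg fun l _ => by split_ifs <;> norm_num)

lemma empCdf_le_one (n : ℕ) (x : ℕ → ℝ) (a : ℝ) : empCdf n x a ≤ 1 := by
  rw [empCdf_eq_sum]
  have h1 : ∑ l ∈ Finset.range n, (if x l ≤ a then (1 : ℝ) else 0) ≤ n :=
    (Finset.sum_le_sum (g := fun _ => (1 : ℝ)) fun l _ => by split_ifs <;> norm_num).trans_eq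
      (by simp)
  calc _ ≤ 1 / (n : ℝ) * n := by gcongr
    _ ≤ 1 := by rw [one_div]; exact inv_mul_le_one

lemma abs_empCdf_sub_le_one (n : ℕ) (x y : ℕ → ℝ) (a : ℝ) :
    |empCdf n x a - empCdf n y a| ≤ 1 := by
  have h1 := empCdf_nonneg n x a
  have h2 := empCdf_le_one n x a
  have h3 := empCdf_nonneg n y a
  have h4 := empCdf_le_one n y a
  exact abs_le.2 ⟨by linarith, by linarith⟩

lemma ksEst_le_one (n : ℕ) (x y : ℕ → ℝ) : ksEst n x y ≤ 1 :=
  ciSup_le fun a => abs_empCdf_sub_le_one n x y a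

/-- The supremum over the real line is attained at one of the samples, as the empirical distribution
functions are constant between them. -/
lemma ksEst_eq_iSup (n : ℕ) (x y : ℕ → ℝ) :
    ksEst n x y = ⨆ q : Fin n ⊕ Fin n,
      |empCdf n x (q.elim (fun l : Fin n => x l) fun l : Fin n => y l) -
        empCdf n y (q.elim (fun l : Fin n => x l) fun l : Fin n => y l)| := by
  set z : Fin n ⊕ Fin n → ℝ := fun q => q.elim (fun l : Fin n => x l) fun l : Fin n => y l
  have hbdd : BddAbove (Set.range fun a => |empCdf n x a - empCdf n y a|) :=
    ⟨1, by rintro _ ⟨a, rfl⟩; exact abs_empCdf_sub_le_one n x y a⟩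
  have hnn : 0 ≤ ksEst n x y := Real.iSup_nonneg fun a => abs_nonneg _
  refine le_antisymm (ciSup_le fun a => ?_)
    (Real.iSup_le (fun q => le_ciSup hbdd (z q)) hnn)
  by_cases hne : (Finset.univ.filter fun q => z q ≤ a).Nonempty
  · obtain ⟨q, hq, hmax⟩ := Finset.exists_max_image _ z hne
    simp only [Finset.mem_filter, Finset.mem_univ, true_and] at hq hmax
    have hx : empCdf n x a = empCdf n x (z q) := by
      rw [empCdf_eq_sum, empCdf_eq_sum]
      congr 1
      refine Finset.sum_congr rfl fun l hl => if_congr ⟨fun h => ?_, fun h => h.trans hq⟩ rfl rfl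
      exact hmax (Sum.inl ⟨l, Finset.mem_range.1 hl⟩) h
    have hy : empCdf n y a = empCdf n y (z q) := by
      rw [empCdf_eq_sum, empCdf_eq_sum]
      congr 1
      refine Finset.sum_congr rfl fun l hl => if_congr ⟨fun h => ?_, fun h => h.trans hq⟩ rfl rfl
      exact hmax (Sum.inr ⟨l, Finset.mem_range.1 hl⟩) h
    rw [hx, hy]
    exact le_ciSup (f := fun q => |empCdf n x (z q) - empCdf n y (z q)|)
      (Set.finite_range _).bddAbove q
  · have hlt (q : Fin n ⊕ Fin n) : ¬ z q ≤ a := fun h => hne ⟨q, by simpa using h⟩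
    have hx : empCdf n x a = 0 := by
      rw [empCdf_eq_sum, Finset.sum_eq_zero, mul_zero]
      exact fun l hl => if_neg (hlt (Sum.inl ⟨l, Finset.mem_range.1 hl⟩))
    have hy : empCdf n y a = 0 := by
      rw [empCdf_eq_sum, Finset.sum_eq_zero, mul_zero]
      exact fun l hl => if_neg (hlt (Sum.inr ⟨l, Finset.mem_range.1 hl⟩))
    rw [hx, hy, sub_zero, abs_zero]
    exact Real.iSup_nonneg fun q => abs_nonneg _

lemma measurable_ksEst {Ω : Type*} [MeasurableSpace Ω] {X Y : ℕ → Ω → ℝ}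
    (hX : ∀ l, Measurable (X l)) (hY : ∀ l, Measurable (Y l)) (n : ℕ) :
    Measurable fun ω => ksEst n (fun l => X l ω) (fun l => Y l ω) := by
  simp_rw [ksEst_eq_iSup, empCdf_eq_sum]
  refine Measurable.iSup fun q => ?_
  have hz : Measurable fun ω => q.elim (fun l : Fin n => X l ω) fun l : Fin n => Y l ω := by
    rcases q with l | l
    · exact hX l
    · exact hY l
  have hsum {Z : ℕ → Ω → ℝ} (hZ : ∀ l, Measurable (Z l)) : Measurable fun ω =>
      (1 / (n : ℝ)) * ∑ l ∈ Finset.range n,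
        if Z l ω ≤ q.elim (fun l : Fin n => X l ω) (fun l : Fin n => Y l ω) then (1 : ℝ) else 0 :=
    (Finset.measurable_fun_sum _ fun l _ =>
      Measurable.ite (measurableSet_le (hZ l) hz) measurable_const measurable_const).const_mul _
  exact ((hsum hX).sub (hsum hY)).abs

/-- Between samples the empirical distribution function is constant while the distribution function
is monotone, so their distance is controlled by the values at the samples and by the left limits
there. -/
lemma abs_empCdf_sub_cdf_le {p : Measure ℝ} [IsProbabilityMeasure p] {n : ℕ} (hn : 0 < n)
    {x : ℕ → ℝ} {ε : ℝ} (hε : 0 ≤ ε)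
    (h : ∀ l ∈ Finset.range n, |∑ i ∈ Finset.range n,
      ((if x i ≤ x l then (1 : ℝ) else 0) - p.real (Set.Iic (x l)))| ≤ n * ε)
    (h' : ∀ l ∈ Finset.range n, |∑ i ∈ Finset.range n,
      ((if x i < x l then (1 : ℝ) else 0) - p.real (Set.Iio (x l)))| ≤ n * ε) (a : ℝ) :
    |empCdf n x a - cdf p a| ≤ ε := by
  have hn0 : (0 : ℝ) < n := by exact_mod_cast hn
  rw [cdf_eq_real, empCdf_eq_sum]
  have hdiff : (1 / (n : ℝ)) * (∑ l ∈ Finset.range n, if x l ≤ a then (1 : ℝ) else 0) -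
      p.real (Set.Iic a) = (∑ l ∈ Finset.range n,
        ((if x l ≤ a then (1 : ℝ) else 0) - p.real (Set.Iic a))) / n := by
    rw [Finset.sum_sub_distrib, Finset.sum_const, Finset.card_range, nsmul_eq_mul]
    field_simp
  rw [hdiff, abs_le, le_div_iff₀ hn0, div_le_iff₀ hn0]
  constructor
  -- The smallest sample above `a`; without one, the empirical distribution function is `1` at `a`.
  · by_cases hne : ((Finset.range n).filter fun l => a < x l).Nonempty
    · obtain ⟨l, hl, hmin⟩ := Finset.exists_min_image _ x hne
      simp only [Finset.mem_filter] at hl hmin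
      have h1 := (abs_le.1 (h' l hl.1)).1
      refine le_trans (by linarith) (h1.trans (Finset.sum_le_sum fun i hi => ?_))
      have h2 : (if x i < x l then (1 : ℝ) else 0) ≤ if x i ≤ a then (1 : ℝ) else 0 := by
        by_cases hia : x i ≤ a
        · rw [if_pos hia]
          split_ifs <;> norm_num
        · rw [if_neg hia, if_neg (hmin i ⟨hi, not_le.1 hia⟩).not_gt]
      have h3 : p.real (Set.Iic a) ≤ p.real (Set.Iio (x l)) :=
        measureReal_mono fun y hy => (Set.mem_Iic.1 hy).trans_lt hl.2
      linarith
    · refine le_trans (by nlinarith) (Finset.sum_nonneg fun i hi => ?_)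
      have hia : x i ≤ a := by
        by_contra hia
        exact hne ⟨i, Finset.mem_filter.2 ⟨hi, not_le.1 hia⟩⟩
      rw [if_pos hia]
      linarith [measureReal_le_one (μ := p) (s := Set.Iic a)]
  -- The largest sample up to `a`; without one, the empirical distribution function is `0` at `a`.
  · by_cases hne : ((Finset.range n).filter fun l => x l ≤ a).Nonempty
    · obtain ⟨l, hl, hmax⟩ := Finset.exists_max_image _ x hne
      simp only [Finset.mem_filter] at hl hmax
      have h1 := (abs_le.1 (h l hl.1)).2
      refine le_trans (Finset.sum_le_sum fun i hi => ?_) (h1.trans (by linarith))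
      have h2 : (if x i ≤ a then (1 : ℝ) else 0) ≤ if x i ≤ x l then (1 : ℝ) else 0 := by
        by_cases hia : x i ≤ a
        · rw [if_pos hia, if_pos (hmax i ⟨hi, hia⟩)]
        · rw [if_neg hia]
          split_ifs <;> norm_num
      have h3 : p.real (Set.Iic (x l)) ≤ p.real (Set.Iic a) :=
        measureReal_mono (Set.Iic_subset_Iic.2 hl.2)
      linarith
    · refine le_trans (Finset.sum_nonpos fun i hi => ?_) (by positivity)
      have hia : ¬ x i ≤ a := fun hia => hne ⟨i, Finset.mem_filter.2 ⟨hi, hia⟩⟩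
      rw [if_neg hia]
      linarith [measureReal_nonneg (μ := p) (s := Set.Iic a)]

lemma abs_iSup_abs_sub_le {f g : ℝ → ℝ} {ε : ℝ} (hf : BddAbove (Set.range fun a => |f a|))
    (hg : BddAbove (Set.range fun a => |g a|)) (h : ∀ a, |f a - g a| ≤ ε) :
    |(⨆ a, |f a|) - (⨆ a, |g a|)| ≤ ε := by
  have h' (a : ℝ) := abs_le.1 ((abs_abs_sub_abs_le_abs_sub (f a) (g a)).trans (h a))
  rw [abs_le, neg_le_sub_iff_le_add, sub_le_iff_le_add]
  constructor
  · exact ciSup_le fun a => by linarith [(h' a).1, le_ciSup hf a]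
  · exact ciSup_le fun a => by linarith [(h' a).2, le_ciSup hg a]

lemma ks_nonneg (p q : Measure ℝ) : 0 ≤ ks p q :=
  Real.iSup_nonneg fun _ => abs_nonneg _

/-- The error of the estimate of the Kolmogorov-Smirnov distance is controlled by one event per
sequence, on which the averages of one of the degenerate kernels `1_{y ≤ x} - p (-∞, x]` and
`1_{y < x} - p (-∞, x)` are not small. -/
lemma exists_ksEst_error {Ω : Type*} [MeasurableSpace Ω] {μ : Measure Ω} [IsProbabilityMeasure μ]
    {M : ℕ} {p : Fin M → Measure ℝ} {X : Fin M → ℕ → Ω → ℝ} (hX : IsIIDFamily μ X p) {ε : ℝ}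
    (hε : 0 < ε) :
    ∃ E : Fin M → ℕ → Set Ω, (∀ i, ∑' n : ℕ, n * μ (E i n) ≠ ⊤) ∧
      ∀ n, 0 < n → ∀ ω i j, ω ∉ E i n → ω ∉ E j n →
        |ksEst n (fun l => X i l ω) (fun l => X j l ω) - ks (p i) (p j)| ≤ ε := by
  have hp (i : Fin M) : IsProbabilityMeasure (p i) :=
    (hX i).2.2 0 ▸ Measure.isProbabilityMeasure_map ((hX i).1 0).aemeasurable
  have hbdd (f g : ℝ → ℝ) (hf : ∀ a, 0 ≤ f a ∧ f a ≤ 1) (hg : ∀ a, 0 ≤ g a ∧ g a ≤ 1) :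
      BddAbove (Set.range fun a => |f a - g a|) := by
    refine ⟨1, ?_⟩
    rintro _ ⟨a, rfl⟩
    exact abs_le.2 ⟨by linarith [(hf a).1, (hg a).2], by linarith [(hf a).2, (hg a).1]⟩
  refine ⟨fun i n => {ω | ∃ l ∈ Finset.range n, n * (ε / 2) < |∑ r ∈ Finset.range n,
      ((if X i r ω ≤ X i l ω then (1 : ℝ) else 0) - (p i).real (Set.Iic (X i l ω)))|} ∪
    {ω | ∃ l ∈ Finset.range n, n * (ε / 2) < |∑ r ∈ Finset.range n,
      ((if X i r ω < X i l ω then (1 : ℝ) else 0) - (p i).real (Set.Iio (X i l ω)))|}, ?_, ?_⟩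
  · intro i
    have key (A : ℝ → Set ℝ) (hA : MeasurableSet {z : ℝ × ℝ | z.2 ∈ A z.1})
        (hmono : Monotone A) : ∑' n : ℕ, (n : ℝ≥0∞) * μ {ω | ∃ l ∈ Finset.range n,
          n * (ε / 2) < |∑ r ∈ Finset.range n,
            ((A (X i l ω)).indicator 1 (X i r ω) - (p i).real (A (X i l ω)))|} ≠ ⊤ := by
      refine tsum_mul_measure_exists_lt_ne_top
        (h := fun x y => (A x).indicator 1 y - (p i).real (A x)) (hX i).1 (hX i).2.1 (hX i).2.2
        ?_ one_pos (fun x y => ?_) (fun x => ?_) (half_pos hε)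
      · have hm : Monotone fun x => (p i).real (A x) := fun x y hxy =>
          measureReal_mono (hmono hxy)
        have h1 : Measurable fun z : ℝ × ℝ => (A z.1).indicator (1 : ℝ → ℝ) z.2 :=
          (measurable_const (a := (1 : ℝ))).indicator hA
        exact h1.sub (hm.measurable.comp measurable_fst)
      · have h1 := measureReal_nonneg (μ := p i) (s := A x)
        have h2 := measureReal_le_one (μ := p i) (s := A x)
        by_cases hy : y ∈ A x
        · rw [Set.indicator_of_mem hy, Pi.one_apply, abs_le]
          constructor <;> linarith
        · rw [Set.indicator_of_notMem hy, abs_le]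
          constructor <;> linarith
      · have hAx : MeasurableSet (A x) := measurable_prodMk_left hA
        rw [integral_sub ((integrable_const 1).indicator hAx) (integrable_const _),
          integral_indicator_one hAx]
        simp
    have h1 := key Set.Iic (measurableSet_le measurable_snd measurable_fst) monotone_Iic
    have h2 := key Set.Iio (measurableSet_lt measurable_snd measurable_fst) monotone_Iio
    simp only [Set.indicator_apply, Set.mem_Iic, Set.mem_Iio, Pi.one_apply] at h1 h2
    refine ne_top_of_le_ne_top (ENNReal.add_ne_top.2 ⟨h1, h2⟩) ?_
    rw [← ENNReal.tsum_add]
    refine ENNReal.tsum_le_tsum fun n => ?_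
    rw [← mul_add]
    gcongr
    exact measure_union_le _ _
  · intro n hn ω i j hi hj
    simp only [Set.mem_union, Set.mem_ofPred_eq, not_or, not_exists, not_and, not_lt] at hi hj
    refine abs_iSup_abs_sub_le
      (hbdd _ _ (fun a => ⟨empCdf_nonneg _ _ a, empCdf_le_one _ _ a⟩)
        (fun a => ⟨empCdf_nonneg _ _ a, empCdf_le_one _ _ a⟩))
      (hbdd _ _ (fun a => ⟨cdf_nonneg _ a, cdf_le_one _ a⟩)
        (fun a => ⟨cdf_nonneg _ a, cdf_le_one _ a⟩)) fun a => ?_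
    have h1 := abs_le.1 (abs_empCdf_sub_cdf_le hn (half_pos hε).le hi.1 hi.2 a)
    have h2 := abs_le.1 (abs_empCdf_sub_cdf_le hn (half_pos hε).le hj.1 hj.2 a)
    exact abs_le.2 ⟨by linarith, by linarith⟩

end KS

/-! ### Maximum mean discrepancy -/

section MMD

open scoped RealInnerProductSpace

variable {𝒳 : Type*} {H : Type*} [NormedAddCommGroup H]
  [InnerProductSpace ℝ H] [CompleteSpace H] [RKHS ℝ H 𝒳 ℝ]

variable (H) in
/-- The canonical feature map `x ↦ k(·, x)` into the reproducing kernel Hilbert space. -/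
noncomputable def feature (x : 𝒳) : H :=
  RKHS.kerFun H x 1

lemma inner_feature (f : H) (x : 𝒳) : ⟪f, feature H x⟫ = f x := by
  simp [feature]

lemma feature_apply (x y : 𝒳) : feature H y x = ker H x y := by
  rw [feature, RKHS.kerFun_apply, ker]

lemma inner_feature_feature (x y : 𝒳) : ⟪feature H x, feature H y⟫ = ker H x y := by
  rw [real_inner_comm, inner_feature, feature_apply]

lemma norm_feature_le {G : ℝ} (hG : ∀ x y : 𝒳, 0 ≤ ker H x y ∧ ker H x y ≤ G) (x : 𝒳) :
    ‖feature H x‖ ≤ Real.sqrt G := by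
  refine Real.le_sqrt_of_sq_le ?_
  rw [← real_inner_self_eq_norm_sq, inner_feature_feature]
  exact (hG x x).2

lemma abs_apply_le {G : ℝ} (hG : ∀ x y : 𝒳, 0 ≤ ker H x y ∧ ker H x y ≤ G) (f : H) (x : 𝒳) :
    |f x| ≤ Real.sqrt G * ‖f‖ := by
  rw [← inner_feature, mul_comm]
  exact (abs_real_inner_le_norm _ _).trans
    (mul_le_mul_of_nonneg_left (norm_feature_le hG x) (norm_nonneg f))

variable (H) in
/-- The empirical mean embedding of the first `n` samples of `x`. -/
noncomputable def empEmbedding (n : ℕ) (x : ℕ → 𝒳) : H :=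
  (1 / (n : ℝ)) • ∑ l ∈ Finset.range n, feature H (x l)

lemma mmdEst_eq_norm (n : ℕ) (x y : ℕ → 𝒳) :
    mmdEst H n x y = ‖empEmbedding H n x - empEmbedding H n y‖ := by
  have hdiff : empEmbedding H n x - empEmbedding H n y =
      (1 / (n : ℝ)) • ∑ l ∈ Finset.range n, (feature H (x l) - feature H (y l)) := by
    rw [empEmbedding, empEmbedding, ← smul_sub, Finset.sum_sub_distrib]
  have hsymm : ∑ l ∈ Finset.range n, ∑ m ∈ Finset.range n, ker H (y l) (x m) =
      ∑ l ∈ Finset.range n, ∑ m ∈ Finset.range n, ker H (x l) (y m) := by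
    rw [Finset.sum_comm]
    simp_rw [← inner_feature_feature, real_inner_comm]
  have hsq : ‖∑ l ∈ Finset.range n, (feature H (x l) - feature H (y l))‖ ^ 2 =
      ∑ l ∈ Finset.range n, ∑ m ∈ Finset.range n,
        (ker H (x l) (x m) + ker H (y l) (y m) - 2 * ker H (x l) (y m)) := by
    rw [← real_inner_self_eq_norm_sq, sum_inner]
    simp_rw [inner_sum, inner_sub_left, inner_sub_right, inner_feature_feature,
      Finset.sum_sub_distrib, Finset.sum_add_distrib, ← Finset.mul_sum]
    rw [hsymm]
    ring
  rw [mmdEst, ← hsq, hdiff, norm_smul, Real.norm_of_nonneg (by positivity), ← one_div_pow,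
    ← mul_pow, Real.sqrt_sq (by positivity)]

lemma norm_empEmbedding_le {G : ℝ} (hG : ∀ x y : 𝒳, 0 ≤ ker H x y ∧ ker H x y ≤ G) (n : ℕ)
    (x : ℕ → 𝒳) : ‖empEmbedding H n x‖ ≤ Real.sqrt G := by
  rw [empEmbedding, norm_smul, Real.norm_of_nonneg (by positivity), one_div]
  have h1 : ‖∑ l ∈ Finset.range n, feature H (x l)‖ ≤ n * Real.sqrt G :=
    (norm_sum_le_of_le _ fun l _ => norm_feature_le hG (x l)).trans_eq (by simp)
  calc _ ≤ (n : ℝ)⁻¹ * (n * Real.sqrt G) := by gcongr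
    _ = ((n : ℝ)⁻¹ * n) * Real.sqrt G := by ring
    _ ≤ 1 * Real.sqrt G := by gcongr; exact inv_mul_le_one
    _ = _ := one_mul _

/-- The squared distance of the empirical mean embedding to the mean embedding is an average of the
centred kernel. -/
lemma norm_empEmbedding_sub_le {n : ℕ} (hn : 0 < n) {x : ℕ → 𝒳} {m : H} {ε : ℝ} (hε : 0 ≤ ε)
    (h : ∀ l ∈ Finset.range n,
      |∑ i ∈ Finset.range n, ⟪feature H (x l) - m, feature H (x i) - m⟫| ≤ n * ε ^ 2) :
    ‖empEmbedding H n x - m‖ ≤ ε := by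
  have hn0 : (0 : ℝ) < n := by exact_mod_cast hn
  have hsub : empEmbedding H n x - m =
      (1 / (n : ℝ)) • ∑ l ∈ Finset.range n, (feature H (x l) - m) := by
    rw [empEmbedding, Finset.sum_sub_distrib, smul_sub, Finset.sum_const, Finset.card_range,
      ← Nat.cast_smul_eq_nsmul ℝ, smul_smul, one_div_mul_cancel hn0.ne', one_smul]
  refine (pow_le_pow_iff_left₀ (norm_nonneg _) hε two_ne_zero).1 ?_
  have hsq : ‖∑ l ∈ Finset.range n, (feature H (x l) - m)‖ ^ 2 = ∑ l ∈ Finset.range n,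
      ∑ i ∈ Finset.range n, ⟪feature H (x l) - m, feature H (x i) - m⟫ := by
    rw [← real_inner_self_eq_norm_sq, sum_inner]
    simp_rw [inner_sum]
  rw [hsub, norm_smul, mul_pow, hsq]
  have h1 : ∑ l ∈ Finset.range n, ∑ i ∈ Finset.range n,
      ⟪feature H (x l) - m, feature H (x i) - m⟫ ≤ ∑ l ∈ Finset.range n, n * ε ^ 2 :=
    Finset.sum_le_sum fun l hl => (le_abs_self _).trans (h l hl)
  rw [Finset.sum_const, Finset.card_range, nsmul_eq_mul] at h1
  calc _ ≤ ‖1 / (n : ℝ)‖ ^ 2 * (n * (n * ε ^ 2)) := by gcongr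
    _ = ε ^ 2 := by
      rw [Real.norm_of_nonneg (by positivity)]
      field_simp

lemma mmdEst_le {G : ℝ} (hG : ∀ x y : 𝒳, 0 ≤ ker H x y ∧ ker H x y ≤ G) (n : ℕ) (x y : ℕ → 𝒳) :
    mmdEst H n x y ≤ Real.sqrt G + Real.sqrt G := by
  rw [mmdEst_eq_norm]
  exact (norm_sub_le _ _).trans
    (add_le_add (norm_empEmbedding_le hG n x) (norm_empEmbedding_le hG n y))

variable [MeasurableSpace 𝒳]

/-- The elements of the Hilbert space are measurable functions, as pointwise limits of linear
combinations of kernel functions. -/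
lemma measurable_coe (hk : Measurable (fun z : 𝒳 × 𝒳 => ker H z.1 z.2)) (f : H) :
    Measurable f := by
  have hspan : ∀ g ∈ Submodule.span ℝ {RKHS.kerFun H x v | (x : 𝒳) (v : ℝ)}, Measurable g := by
    intro g hg
    induction hg using Submodule.span_induction with
    | mem g hg =>
      obtain ⟨x, v, rfl⟩ := hg
      have : RKHS.kerFun H x v = v • feature H x := by
        rw [feature, ← map_smul, smul_eq_mul, mul_one]
      rw [this, RKHS.coe_smul]
      have hx : (feature H x : 𝒳 → ℝ) = fun y => ker H y x := funext fun y => feature_apply y x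
      rw [hx]
      exact (hk.comp measurable_prodMk_right).const_smul v
    | zero => rw [RKHS.coe_zero]; exact measurable_const
    | add g g' _ _ hg hg' => rw [RKHS.coe_add]; exact hg.add hg'
    | smul r g _ hg => rw [RKHS.coe_smul]; exact hg.const_smul r
  have hf : f ∈ (Submodule.span ℝ {RKHS.kerFun H x v | (x : 𝒳) (v : ℝ)}).topologicalClosure := by
    rw [RKHS.kerFun_dense]
    trivial
  obtain ⟨u, hu, hlim⟩ := mem_closure_iff_seq_limit.1 hf
  refine measurable_of_tendsto_metrizable (fun n => hspan (u n) (hu n)) ?_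
  rw [tendsto_pi_nhds]
  exact fun x => ((RKHS.continuous_eval x).tendsto f).comp hlim

lemma integrable_coe (hk : Measurable (fun z : 𝒳 × 𝒳 => ker H z.1 z.2)) {G : ℝ}
    (hG : ∀ x y : 𝒳, 0 ≤ ker H x y ∧ ker H x y ≤ G) (p : Measure 𝒳) [IsProbabilityMeasure p]
    (f : H) : Integrable f p :=
  .of_bound (measurable_coe hk f).aestronglyMeasurable _ (ae_of_all _ fun x => abs_apply_le hG f x)

/-- The mean embedding of `p`: the element representing `f ↦ ∫ x, f x ∂p`. -/
lemma exists_meanEmbedding (hk : Measurable (fun z : 𝒳 × 𝒳 => ker H z.1 z.2)) {G : ℝ}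
    (hG : ∀ x y : 𝒳, 0 ≤ ker H x y ∧ ker H x y ≤ G) (p : Measure 𝒳) [IsProbabilityMeasure p] :
    ∃ m : H, ∀ f : H, ⟪m, f⟫ = ∫ x, f x ∂p := by
  let φ : H →ₗ[ℝ] ℝ :=
    { toFun := fun f => ∫ x, f x ∂p
      map_add' := fun f g => by
        simp_rw [RKHS.coe_add, Pi.add_apply]
        exact integral_add (integrable_coe hk hG p f) (integrable_coe hk hG p g)
      map_smul' := fun r f => by
        simp_rw [RKHS.coe_smul, Pi.smul_apply]
        exact integral_smul r _ }
  have hφ (f : H) : ‖φ f‖ ≤ Real.sqrt G * ‖f‖ := by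
    refine (norm_integral_le_of_norm_le_const (ae_of_all p fun x => abs_apply_le hG f x)).trans ?_
    simp
  refine ⟨(InnerProductSpace.toDual ℝ H).symm (φ.mkContinuous _ hφ), fun f => ?_⟩
  rw [InnerProductSpace.toDual_symm_apply]
  rfl

lemma mmd_eq_norm {p q : Measure 𝒳} {m m' : H} (hm : ∀ f : H, ⟪m, f⟫ = ∫ x, f x ∂p)
    (hm' : ∀ f : H, ⟪m', f⟫ = ∫ x, f x ∂q) : mmd H p q = ‖m - m'‖ := by
  have hle : ∀ r ∈ {r : ℝ | ∃ f : H, ‖f‖ ≤ 1 ∧ r = (∫ x, f x ∂p) - ∫ x, f x ∂q},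
      r ≤ ‖m - m'‖ := by
    rintro r ⟨f, hf, rfl⟩
    rw [← hm, ← hm', ← inner_sub_left]
    exact (real_inner_le_norm _ _).trans (mul_le_of_le_one_right (norm_nonneg _) hf)
  refine le_antisymm (csSup_le ⟨0, 0, by simp⟩ hle) (le_csSup ⟨_, hle⟩ ?_)
  refine ⟨‖m - m'‖⁻¹ • (m - m'), ?_, ?_⟩
  · rw [norm_smul, norm_inv, norm_norm]
    exact inv_mul_le_one
  · rw [← hm, ← hm', ← inner_sub_left, inner_smul_right, real_inner_self_eq_norm_sq]
    by_cases h0 : ‖m - m'‖ = 0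
    · simp [h0]
    · field_simp

lemma mmd_nonneg (hk : Measurable (fun z : 𝒳 × 𝒳 => ker H z.1 z.2)) {G : ℝ}
    (hG : ∀ x y : 𝒳, 0 ≤ ker H x y ∧ ker H x y ≤ G) (p q : Measure 𝒳) [IsProbabilityMeasure p]
    [IsProbabilityMeasure q] : 0 ≤ mmd H p q := by
  obtain ⟨m, hm⟩ := exists_meanEmbedding hk hG p
  obtain ⟨m', hm'⟩ := exists_meanEmbedding hk hG q
  rw [mmd_eq_norm hm hm']
  exact norm_nonneg _

lemma measurable_mmdEst {Ω : Type*} [MeasurableSpace Ω]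
    (hk : Measurable (fun z : 𝒳 × 𝒳 => ker H z.1 z.2)) {X Y : ℕ → Ω → 𝒳}
    (hX : ∀ l, Measurable (X l)) (hY : ∀ l, Measurable (Y l)) (n : ℕ) :
    Measurable fun ω => mmdEst H n (fun l => X l ω) (fun l => Y l ω) := by
  have hker {Z Z' : Ω → 𝒳} (hZ : Measurable Z) (hZ' : Measurable Z') :
      Measurable fun ω => ker H (Z ω) (Z' ω) := by
    have h := hk.comp (hZ.prodMk hZ')
    exact h
  unfold mmdEst
  refine Measurable.sqrt (Measurable.const_mul ?_ _)
  refine Finset.measurable_fun_sum _ fun l _ => Finset.measurable_fun_sum _ fun m _ => ?_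
  have h1 := hker (hX l) (hX m)
  have h2 := hker (hY l) (hY m)
  have h3 := hker (hX l) (hY m)
  fun_prop

/-- The error of the estimate of the maximum mean discrepancy is controlled by one event per
sequence, on which the averages of the centred kernel `⟪k_x - m, k_y - m⟫` are not small. -/
lemma exists_mmdEst_error {Ω : Type*} [MeasurableSpace Ω] {μ : Measure Ω} [IsProbabilityMeasure μ]
    {M : ℕ} (hk : Measurable (fun z : 𝒳 × 𝒳 => ker H z.1 z.2)) {G : ℝ}
    (hG : ∀ x y : 𝒳, 0 ≤ ker H x y ∧ ker H x y ≤ G) {p : Fin M → Measure 𝒳}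
    {X : Fin M → ℕ → Ω → 𝒳} (hX : IsIIDFamily μ X p) {ε : ℝ} (hε : 0 < ε) :
    ∃ E : Fin M → ℕ → Set Ω, (∀ i, ∑' n : ℕ, n * μ (E i n) ≠ ⊤) ∧
      ∀ n, 0 < n → ∀ ω i j, ω ∉ E i n → ω ∉ E j n →
        |mmdEst H n (fun l => X i l ω) (fun l => X j l ω) - mmd H (p i) (p j)| ≤ ε := by
  have hp (i : Fin M) : IsProbabilityMeasure (p i) :=
    (hX i).2.2 0 ▸ Measure.isProbabilityMeasure_map ((hX i).1 0).aemeasurable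
  choose m hm using fun i => exists_meanEmbedding hk hG (p i)
  refine ⟨fun i n => {ω | ∃ l ∈ Finset.range n, n * (ε / 2) ^ 2 <
    |∑ r ∈ Finset.range n, ⟪feature H (X i l ω) - m i, feature H (X i r ω) - m i⟫|}, ?_, ?_⟩
  · intro i
    have hh (x y : 𝒳) : ⟪feature H x - m i, feature H y - m i⟫ =
        (feature H x - m i) y - ⟪m i, feature H x - m i⟫ := by
      rw [inner_sub_right, inner_feature, real_inner_comm (feature H x - m i) (m i)]
    refine tsum_mul_measure_exists_lt_ne_top
      (h := fun x y => ⟪feature H x - m i, feature H y - m i⟫) (hX i).1 (hX i).2.1 (hX i).2.2 ?_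
      (B := (Real.sqrt G + ‖m i‖) ^ 2 + 1) (by positivity) (fun x y => ?_) (fun x => ?_)
      (by positivity : 0 < (ε / 2) ^ 2)
    · have heq (z : 𝒳 × 𝒳) : ⟪feature H z.1 - m i, feature H z.2 - m i⟫ =
          ker H z.1 z.2 - m i z.1 - (m i z.2 - ⟪m i, m i⟫) := by
        rw [inner_sub_left, inner_sub_right, inner_sub_right, inner_feature_feature, inner_feature,
          real_inner_comm, inner_feature]
      simp_rw [heq]
      have := measurable_coe hk (m i)
      fun_prop
    · have hb (z : 𝒳) : ‖feature H z - m i‖ ≤ Real.sqrt G + ‖m i‖ :=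
        (norm_sub_le _ _).trans (add_le_add_left (norm_feature_le hG z) _)
      have h1 := (abs_real_inner_le_norm (feature H x - m i) (feature H y - m i)).trans
        (mul_le_mul (hb x) (hb y) (norm_nonneg _) (by positivity))
      rw [sq]
      linarith
    · simp_rw [hh]
      rw [integral_sub (integrable_coe hk hG _ _) (integrable_const _), ← hm]
      simp
  · intro n hn ω i j hi hj
    simp only [Set.mem_ofPred_eq, not_exists, not_and, not_lt] at hi hj
    have h1 := norm_empEmbedding_sub_le hn (half_pos hε).le hi
    have h2 := norm_empEmbedding_sub_le hn (half_pos hε).le hj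
    rw [mmdEst_eq_norm, mmd_eq_norm (hm i) (hm j)]
    refine (abs_norm_sub_norm_le _ _).trans ?_
    rw [sub_sub_sub_comm]
    exact (norm_sub_le _ _).trans (by linarith)

end MMD

end SlinkSeq

/-! ### Convergence of the normalized stopping time -/

theorem theorem4 {Ω : Type*} [MeasurableSpace Ω] (μ : Measure Ω) [IsProbabilityMeasure μ]
    (M K : ℕ) (hK : 2 ≤ K) (c : Fin M → Fin K) (hc : Function.Surjective c)
    (tie : Finset (Finset (Fin M) × Finset (Fin M)) → Finset (Fin M) × Finset (Fin M))
    (htie : IsTieBreak tie) :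
    -- maximum mean discrepancy
    (∀ (𝒳 : Type*) [MeasurableSpace 𝒳] (H : Type*) [NormedAddCommGroup H] [InnerProductSpace ℝ H]
        [CompleteSpace H] [RKHS ℝ H 𝒳 ℝ] (G : ℝ),
      Measurable (fun z : 𝒳 × 𝒳 => ker H z.1 z.2) →
      (∀ x y : 𝒳, 0 ≤ ker H x y ∧ ker H x y ≤ G) →
      ∀ (p : Fin M → Measure 𝒳) (X : Fin M → ℕ → Ω → 𝒳), IsIIDFamily μ X p →
      ∀ d : Fin M → Fin M → ℝ, d = (fun i j => mmd H (p i) (p j)) →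
      dI d c < dH d c →
      ∀ N : ℝ → Ω → ℕ∞,
      N = (fun C ω => stoppingTime K tie
        (fun n i j => mmdEst H n (fun l => X i l ω) (fun l => X j l ω)) C) →
      (∀ C : ℝ, 0 < C → Measurable (N C)) ∧
      Tendsto (fun C : ℝ => meanDeviation μ (N C) C (1 / dH d c ^ 2)) atTop (𝓝 0)) ∧
    -- Kolmogorov-Smirnov distance
    (∀ (p : Fin M → Measure ℝ) (X : Fin M → ℕ → Ω → ℝ), IsIIDFamily μ X p →
      ∀ d : Fin M → Fin M → ℝ, d = (fun i j => ks (p i) (p j)) →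
      dI d c < dH d c →
      ∀ N : ℝ → Ω → ℕ∞,
      N = (fun C ω => stoppingTime K tie
        (fun n i j => ksEst n (fun l => X i l ω) (fun l => X j l ω)) C) →
      (∀ C : ℝ, 0 < C → Measurable (N C)) ∧
      Tendsto (fun C : ℝ => meanDeviation μ (N C) C (1 / dH d c ^ 2)) atTop (𝓝 0)) := by
  constructor
  · intro 𝒳 _ H _ _ _ _ G hk hG p X hX d hd hgap N hN
    subst hd hN
    have hp (i : Fin M) : IsProbabilityMeasure (p i) :=
      (hX i).2.2 0 ▸ Measure.isProbabilityMeasure_map ((hX i).1 0).aemeasurable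
    refine ⟨fun C _ => measurable_stoppingTime
        (fun n i j => measurable_mmdEst hk (hX i).1 (hX j).1 n) C,
      tendsto_meanDeviation hK hc htie (fun i j => mmd_nonneg hk hG _ _) hgap
        (B := Real.sqrt G + Real.sqrt G) (by positivity) (fun n ω i j => mmdEst_le hG n _ _)
        fun ε hε => exists_mmdEst_error hk hG hX hε⟩
  · intro p X hX d hd hgap N hN
    subst hd hN
    exact ⟨fun C _ => measurable_stoppingTime
        (fun n i j => measurable_ksEst (hX i).1 (hX j).1 n) C,
      tendsto_meanDeviation hK hc htie (fun i j => ks_nonneg _ _) hgap zero_le_one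
        (fun n ω i j => ksEst_le_one n _ _) fun ε hε => exists_ksEst_error hX hε⟩
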